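/- Let $X_1,\dots,X_n$ be i.i.d. random variables with law $D$ in a measurable space $\mathcal X$, put $S=(X_1,\dots,X_n)$, let $\Theta$ be a measurable space, let $f:\Theta\times\mathcal X\to[0,1]$ be measurable, and let $\mu_\theta=\int f(\theta,x)\,D(dx)$. Let $P_0$ be a fixed (data-independent) probability measure on $\Theta$, let $P$ be a probability kernel from $\mathcal X^n$ to $\Theta$, and write $P_n=P(S)$. For $\nu\in[0,1]$ define $$\psi_n^\star(\theta,\nu)=\max_{-\frac1{1-\nu}\le\lambda\le\frac1\nu}\ \sum_{i=1}^n\ln\bigl(1+\lambda(f(\theta,X_i)-\nu)\bigr)\in[0,\infty],\qquad \mathcal C_n=\mathrm{KL}(P_n\|P_0)+\ln\frac{\sqrt\pi\,\Gamma(n+1)}{\Gamma(n+\frac12)}$$ (with $1/0=+\infty$, $\ln 0=-\infty$, a maximum being read as a supremum, and $\mathrm{KL}(P_n\|P_0)=+\infty$ if $P_n\not\ll P_0$), and let $\mathsf{kl}(p,q)=p\ln\frac pq+(1-p)\ln\frac{1-p}{1-q}$ be the Kullback–Leibler divergence between the Bernoulli distributions with parameters $p,q\in[0,1]$. Let $\delta\in(0,1]$,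 $K=\lceil\ln(1/\delta)\rceil$ and $m\ge1$. The Monte Carlo algorithm does the following. 1. Given $S$, it draws $K$ independent blocks $(\theta_i)_{i\in B_k}\sim P_n^{\otimes m}$, where $B_k=\{(k-1)m+1,\dots,km\}$, $k=1,\dots,K$. 2. For each $k$ it computes the maximum $\bar\nu_U(k)$ and the minimum $\bar\nu_L(k)$ of $\frac1m\sum_{i\in B_k}\nu_{\theta_i}$ over all $(\nu_{\theta_i})_{i\in B_k}\in[0,1]^{B_k}$ with $$\frac1{em}\sum_{i\in B_k}\psi_n^\star(\theta_i,\nu_{\theta_i})\le\mathcal C_n+\ln\frac1\delta .$$ 3. With $\hat k_U=\arg\max_k\bar\nu_U(k)$ and $\hat k_L=\arg\min_k\bar\nu_L(k)$, it outputs $$M_U=\max\Bigl\{\mu\in[0,1]:\mathsf{kl}\bigl(\bar\nu_U(\hat k_U),\mu\bigr)\le\frac{\ln\frac{K}{2\delta}}m\Bigr\},\qquad M_L=\min\Bigl\{\mu\in[0,1]:\mathsf{kl}\bigl(\bar\nu_L(\hat k_L),\mu\bigr)\le\frac{\ln\frac{K}{2\delta}}m\Bigr\}.$$ Then, with probability at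 least $1-3\delta$ over $S$ and the sampled parameters, $$M_L\le\int\mu_\theta\,dP_n(\theta)\le M_U .$$ -/

import Mathlib

open MeasureTheory ProbabilityTheory

noncomputable section

namespace PacBayes

/-- The set of bets `λ` with `-1/(1-ν) ≤ λ ≤ 1/ν`, for `ν ∈ [0,1]`. The two inequalities are written
without division, so that `1/0` is read as `+∞` when `ν = 0` or `ν = 1`. -/
def admissibleBets (ν : ℝ) : Set ℝ :=
  {l | -1 ≤ l * (1 - ν) ∧ l * ν ≤ 1}

/-- The optimal log-wealth
`ψₙ⋆(θ, ν) = max_{-1/(1-ν) ≤ λ ≤ 1/ν} ∑ᵢ ln (1 + λ (f(θ, xᵢ) - ν))` of the parameter `θ` on the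
sample `x`. It is extended-real valued, with `ln 0 = -∞`. For an admissible `λ` all the arguments
`1 + λ (f(θ, xᵢ) - ν)` are nonnegative. -/
def optLogWealth {Θ 𝒳 : Type*} (f : Θ → 𝒳 → ℝ) {n : ℕ} (x : Fin n → 𝒳) (θ : Θ) (ν : ℝ) : EReal :=
  ⨆ l ∈ admissibleBets ν, ∑ i, ENNReal.log (ENNReal.ofReal (1 + l * (f θ (x i) - ν)))

/-- The complexity term `𝒞ₙ = KL(Q ‖ P₀) + ln (√π Γ(n+1) / Γ(n+1/2))`, with `KL(Q ‖ P₀) = +∞` when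
`Q` is not absolutely continuous with respect to `P₀`. -/
def complexity {Θ : Type*} [MeasurableSpace Θ] (n : ℕ) (Q P₀ : Measure Θ) : EReal :=
  (InformationTheory.klDiv Q P₀ : EReal) +
    ((Real.log (Real.sqrt Real.pi * Real.Gamma ((n : ℝ) + 1) / Real.Gamma ((n : ℝ) + 1 / 2)) : ℝ) :
      EReal)

/-- The feasible points `(ν_{θᵢ})ᵢ ∈ [0,1]ᵐ` of the optimization problem of one block
`θ = (θ₁, …, θₘ)` of sampled parameters:
`(1 / (e m)) ∑ᵢ ψₙ⋆(θᵢ, ν_{θᵢ}) ≤ 𝒞ₙ + ln (1/δ)`. -/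
def feasible {Θ 𝒳 : Type*} [MeasurableSpace Θ] (f : Θ → 𝒳 → ℝ) (Q P₀ : Measure Θ) (δ : ℝ) {n m : ℕ}
    (x : Fin n → 𝒳) (θ : Fin m → Θ) : Set (Fin m → ℝ) :=
  {ν | (∀ i, ν i ∈ Set.Icc (0 : ℝ) 1) ∧
    ((1 / (Real.exp 1 * (m : ℝ)) : ℝ) : EReal) * ∑ i, optLogWealth f x (θ i) (ν i) ≤
      complexity n Q P₀ + ((Real.log (1 / δ) : ℝ) : EReal)}

/-- The values `(1/m) ∑ᵢ ν_{θᵢ}` of the objective of one block over its feasible points. -/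
def blockValues {Θ 𝒳 : Type*} [MeasurableSpace Θ] (f : Θ → 𝒳 → ℝ) (Q P₀ : Measure Θ) (δ : ℝ)
    {n m : ℕ} (x : Fin n → 𝒳) (θ : Fin m → Θ) : Set ℝ :=
  (fun ν : Fin m → ℝ => 1 / (m : ℝ) * ∑ i, ν i) '' feasible f Q P₀ δ x θ

/-- The binary relative entropy `p ln (p/q) + (1-p) ln ((1-p)/(1-q))` for `p, q ∈ [0,1]`, that is the
Kullback-Leibler divergence between the Bernoulli distributions with parameters `p` and `q`. It is
`+∞` when the first distribution is not absolutely continuous with respect to the second, and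
`0 ln 0 = 0`. -/
def binaryKL (p q : ℝ) : EReal :=
  open Classical in
  if (q = 0 ∧ p ≠ 0) ∨ (q = 1 ∧ p ≠ 1) then ⊤
  else ((p * Real.log (p / q) + (1 - p) * Real.log ((1 - p) / (1 - q)) : ℝ) : EReal)

/-- The set of means `u ∈ [0,1]` with `kl(v, u) ≤ ln (K / (2δ)) / m`. -/
def klBall (δ : ℝ) (K m : ℕ) (v : ℝ) : Set ℝ :=
  {u | u ∈ Set.Icc (0 : ℝ) 1 ∧
    binaryKL v u ≤ ((Real.log ((K : ℝ) / (2 * δ)) / (m : ℝ) : ℝ) : EReal)}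

/-- The output `M_U` of the Monte Carlo procedure on the sample `x`, with posterior `Q`, prior `P₀`
and sampled parameters `θ k i` (block `k`, position `i` in the block): maximize in each block, take
the largest of the optimal values, and invert the binary relative entropy upwards. -/
def upperOutput {Θ 𝒳 : Type*} [MeasurableSpace Θ] (f : Θ → 𝒳 → ℝ) (Q P₀ : Measure Θ) (δ : ℝ)
    {n K m : ℕ} (x : Fin n → 𝒳) (θ : Fin K → Fin m → Θ) : ℝ :=
  sSup (klBall δ K m (⨆ k, sSup (blockValues f Q P₀ δ x (θ k))))

/-- The output `M_L` of the Monte Carlo procedure: minimize in each block, take the smallest of the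
optimal values, and invert the binary relative entropy downwards. -/
def lowerOutput {Θ 𝒳 : Type*} [MeasurableSpace Θ] (f : Θ → 𝒳 → ℝ) (Q P₀ : Measure Θ) (δ : ℝ)
    {n K m : ℕ} (x : Fin n → 𝒳) (θ : Fin K → Fin m → Θ) : ℝ :=
  sInf (klBall δ K m (⨅ k, sInf (blockValues f Q P₀ δ x (θ k))))

/-- The kernel `s ↦ (κ s)^{⊗ N}` of `N` independent draws from `κ s`. -/
def iidKernel {α β : Type*} [MeasurableSpace α] [MeasurableSpace β] (κ : Kernel α β)
    [IsMarkovKernel κ] (N : ℕ) : Kernel α (Fin N → β) where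
  toFun s := Measure.pi fun _ => κ s
  measurable' := by
    refine Measurable.measure_of_isPiSystem_of_isProbabilityMeasure
      generateFrom_pi.symm isPiSystem_pi ?_
    rintro _ ⟨t, ht, rfl⟩
    simp only [Measure.pi_pi]
    exact Finset.measurable_fun_prod _ fun i _ =>
      κ.measurable_coe (ht i (Set.mem_univ i))

instance {α β : Type*} [MeasurableSpace α] [MeasurableSpace β] (κ : Kernel α β)
    [IsMarkovKernel κ] (N : ℕ) : IsMarkovKernel (iidKernel κ N) :=
  ⟨fun s => by
    change IsProbabilityMeasure (Measure.pi fun _ : Fin N => κ s)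
    infer_instance⟩

end PacBayes

end

noncomputable section

namespace PacBayes

/-! ### Half-integer rising factorials and the Krichevsky–Trofimov weights -/

/-! Fix a parameter. The Krichevsky–Trofimov mixture `ktWealth` of bets dominates the wealth of
every constant admissible bet up to the factor `regret n` (`ofReal_prod_le_regret_mul_ktWealth`),
and against the true mean its expectation over the sample is at most one
(`lintegral_ktWealth_le_one`). Averaging over the data-independent prior gives `w = priorWealth`
with expectation at most one. Donsker–Varadhan (`lintegral_posLog_le`) then bounds the posterior
mean of the log-wealth by the complexity plus `ln (1/δ)` plus `log⁺ (δ w)`.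

Given the sample, a block is bad if the true means violate its constraint. By Markov this has
probability at most `p = e⁻¹ (1 + log⁺ (δ w) / ln (1/δ))`. A Chernoff bound shows that the block
average of the true means is too low, or too high, with probability at most `s = 2δ/K` each. Since
the outputs use the best block, the upper bound fails only if every block is bad or low, and the
lower bound only if every block is bad or high. Counting the all-bad event once gives conditional
failure probability at most `2 (p + s)^K - p^K` (`measure_pi_union_le`).

The sample is not split into good and bad by Markov on `w`. Instead this conditional bound, capped
at one, is majorized by `c₀ + c₁ w` with `c₀ + c₁ ≤ 3δ` (`exists_affine_majorant`), and integrating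
over the sample uses only that `w` has mean at most one. The case `δ ≥ 1/3` is vacuous. -/

/-- The rising factorial `(1/2) (3/2) ⋯ (k - 1/2)`. -/
def halfRising (k : ℕ) : ℝ := ∏ j ∈ Finset.range k, ((j : ℝ) + 1 / 2)

lemma halfRising_zero : halfRising 0 = 1 := by simp [halfRising]

lemma halfRising_succ (k : ℕ) : halfRising (k + 1) = halfRising k * ((k : ℝ) + 1 / 2) := by
  simp [halfRising, Finset.prod_range_succ]

lemma halfRising_pos (k : ℕ) : 0 < halfRising k :=
  Finset.prod_pos fun _ _ => by positivity

lemma Gamma_nat_add_half_eq (k : ℕ) :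
    Real.Gamma ((k : ℝ) + 1 / 2) = halfRising k * Real.sqrt Real.pi := by
  induction k with
  | zero => simp [halfRising_zero, ← Real.Gamma_one_half_eq]
  | succ k ih =>
    have h : ((k + 1 : ℕ) : ℝ) + 1 / 2 = ((k : ℝ) + 1 / 2) + 1 := by push_cast; ring
    rw [h, Real.Gamma_add_one (by positivity), ih, halfRising_succ]
    ring

/-- The regret factor `√π Γ(n+1) / Γ(n+1/2)` as a quotient of factorials. -/
def regret (n : ℕ) : ℝ := (n.factorial : ℝ) / halfRising n

lemma regret_pos (n : ℕ) : 0 < regret n :=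
  div_pos (by exact_mod_cast n.factorial_pos) (halfRising_pos n)

lemma sqrt_pi_mul_Gamma_div_Gamma (n : ℕ) :
    Real.sqrt Real.pi * Real.Gamma ((n : ℝ) + 1) / Real.Gamma ((n : ℝ) + 1 / 2) = regret n := by
  have h : 0 < Real.sqrt Real.pi := Real.sqrt_pos.2 Real.pi_pos
  have := halfRising_pos n
  rw [Gamma_nat_add_half_eq, Real.Gamma_nat_eq_factorial, regret]
  field_simp

lemma halfRising_le_factorial (n : ℕ) : halfRising n ≤ n.factorial := by
  induction n with
  | zero => simp [halfRising_zero]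
  | succ n ih =>
    rw [halfRising_succ, Nat.factorial_succ, mul_comm]
    push_cast
    have := halfRising_pos n
    gcongr
    norm_num

lemma one_le_regret (n : ℕ) : 1 ≤ regret n :=
  (one_le_div (halfRising_pos n)).2 (halfRising_le_factorial n)

/-- The derivative is `1/(x + 1/2) - log (1 + 1/x)`, nonpositive by `log (1 + u) ≥ 2u/(u + 2)` at `u
= 1/x`. The function is the logarithm of the one-step ratio in the induction of
`pow_self_mul_halfRising_le`. -/
lemma log_ratio_antitoneOn :
    AntitoneOn (fun x : ℝ => Real.log (x + 1 / 2) + x * Real.log x - (x + 1) * Real.log (x + 1))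
      (Set.Ici 0) := by
  have hd : ∀ x : ℝ, 0 < x → HasDerivAt
      (fun x : ℝ => Real.log (x + 1 / 2) + x * Real.log x - (x + 1) * Real.log (x + 1))
      (1 / (x + 1 / 2) + Real.log x - Real.log (x + 1)) x := by
    intro x hx
    have h1 : HasDerivAt (fun x : ℝ => Real.log (x + 1 / 2)) (1 / (x + 1 / 2)) x :=
      ((hasDerivAt_id x).add_const (1 / 2)).log (by simp; positivity)
    have h2 : HasDerivAt (fun x : ℝ => x * Real.log x) (Real.log x + 1) x :=
      Real.hasDerivAt_mul_log hx.ne'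
    have h3 : HasDerivAt (fun x : ℝ => (x + 1) * Real.log (x + 1)) (Real.log (x + 1) + 1) x :=
      HasDerivAt.comp_add_const x 1 (Real.hasDerivAt_mul_log (by positivity))
    exact ((h1.add h2).sub h3).congr_deriv (by ring)
  refine antitoneOn_of_deriv_nonpos (convex_Ici 0) ?_ ?_ ?_
  · refine ContinuousOn.sub (ContinuousOn.add ?_ Real.continuous_mul_log.continuousOn) ?_
    · exact ContinuousOn.log (by fun_prop) fun x hx => by
        have : (0 : ℝ) ≤ x := hx
        positivity
    · exact (Real.continuous_mul_log.comp (by fun_prop : Continuous fun x : ℝ => x + 1)).continuousOn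
  · intro x hx
    rw [interior_Ici] at hx
    exact (hd x hx).differentiableAt.differentiableWithinAt
  · intro x hx
    rw [interior_Ici] at hx
    have hx0 : (0 : ℝ) < x := hx
    rw [(hd x hx).deriv]
    have h := Real.le_log_one_add_of_nonneg (x := 1 / x) (by positivity)
    have e1 : 2 * (1 / x) / (1 / x + 2) = 1 / (x + 1 / 2) := by field_simp; ring
    have e2 : Real.log (1 + 1 / x) = Real.log (x + 1) - Real.log x := by
      rw [← Real.log_div (by positivity) (by positivity)]
      congr 1
      field_simp
    rw [e1, e2] at h
    linarith

lemma ratio_le_ratio {l k : ℕ} (h : l ≤ k) :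
    ((k : ℝ) + 1 / 2) * (k : ℝ) ^ k / ((k : ℝ) + 1) ^ (k + 1) ≤
      ((l : ℝ) + 1 / 2) * (l : ℝ) ^ l / ((l : ℝ) + 1) ^ (l + 1) := by
  have hpow : ∀ j : ℕ, (0 : ℝ) < (j : ℝ) ^ j := by
    intro j
    rcases Nat.eq_zero_or_pos j with rfl | hj
    · simp
    · exact pow_pos (by exact_mod_cast hj) _
  have hlog : ∀ j : ℕ, Real.log (((j : ℝ) + 1 / 2) * (j : ℝ) ^ j / ((j : ℝ) + 1) ^ (j + 1)) =
      Real.log ((j : ℝ) + 1 / 2) + j * Real.log j - (j + 1) * Real.log (j + 1) := by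
    intro j
    have := hpow j
    rw [Real.log_div (by positivity) (by positivity), Real.log_mul (by positivity) (by positivity),
      Real.log_pow, Real.log_pow]
    push_cast
    ring
  have hk := hpow k
  have hl := hpow l
  rw [← Real.log_le_log_iff (by positivity) (by positivity), hlog, hlog]
  exact log_ratio_antitoneOn (Set.mem_Ici.2 (Nat.cast_nonneg l)) (Set.mem_Ici.2 (Nat.cast_nonneg k))
    (by exact_mod_cast h)

/-- This is the regret bound at the maximum likelihood parameter, and the worst case is a constant
sequence: equality holds at `l = 0`. Each increment of `l` multiplies the two sides by factors whose
comparison is `ratio_le_ratio` between `l` and `k + l`. -/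
lemma pow_self_mul_halfRising_le (k l : ℕ) :
    (k : ℝ) ^ k * (l : ℝ) ^ l * halfRising (k + l) ≤
      ((k + l : ℕ) : ℝ) ^ (k + l) * (halfRising k * halfRising l) := by
  induction l with
  | zero => simp [halfRising_zero]
  | succ l ih =>
    have hr := ratio_le_ratio (Nat.le_add_left l k)
    rw [div_le_div_iff₀ (by positivity) (by positivity)] at hr
    rw [← add_assoc, halfRising_succ, halfRising_succ]
    have hpow : (0 : ℝ) < (l : ℝ) ^ l * ((k + l : ℕ) : ℝ) ^ (k + l) := by
      have : ∀ j : ℕ, (0 : ℝ) < (j : ℝ) ^ j := by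
        intro j
        rcases Nat.eq_zero_or_pos j with rfl | hj
        · simp
        · exact pow_pos (by exact_mod_cast hj) _
      exact mul_pos (this _) (this _)
    have hA := halfRising_pos k
    have hB := halfRising_pos l
    have hC := halfRising_pos (k + l)
    refine le_of_mul_le_mul_right ?_ hpow
    have e1 : ((l + 1 : ℕ) : ℝ) = (l : ℝ) + 1 := by push_cast; ring
    have e2 : ((k + l + 1 : ℕ) : ℝ) = ((k + l : ℕ) : ℝ) + 1 := by push_cast; ring
    rw [e1, e2]
    have hs : (0 : ℝ) ≤ ((k + l : ℕ) : ℝ) := Nat.cast_nonneg _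
    generalize ((k + l : ℕ) : ℝ) = s at *
    calc _ = ((k : ℝ) ^ k * (l : ℝ) ^ l * halfRising (k + l)) *
          ((s + 1 / 2) * s ^ (k + l) * ((l : ℝ) + 1) ^ (l + 1)) := by ring
      _ ≤ (s ^ (k + l) * (halfRising k * halfRising l)) *
          (((l : ℝ) + 1 / 2) * (l : ℝ) ^ l * (s + 1) ^ (k + l + 1)) := by
        exact mul_le_mul ih hr (by positivity) (by positivity)
      _ = _ := by ring

lemma pow_mul_pow_le_pow_self {b c : ℝ} (hb : 0 ≤ b) (hc : 0 ≤ c) (hbc : b + c = 1) (k l : ℕ) :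
    b ^ k * c ^ l * ((k + l : ℕ) : ℝ) ^ (k + l) ≤ (k : ℝ) ^ k * (l : ℝ) ^ l := by
  -- The inequality `u ≤ exp (u - 1)` at `u = t/j`, raised to the power `j`. For `t = b s` and `t =
  -- c s` the two exponents cancel because `b + c = 1`.
  have key : ∀ (t : ℝ) (j : ℕ), 0 ≤ t → t ^ j ≤ (j : ℝ) ^ j * Real.exp (t - j) := by
    intro t j ht
    rcases Nat.eq_zero_or_pos j with rfl | hj
    · simpa using ht
    have hj' : (0 : ℝ) < j := by exact_mod_cast hj
    have h1 : t / j ≤ Real.exp (t / j - 1) := by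
      have := Real.add_one_le_exp (t / j - 1)
      linarith
    have h2 := pow_le_pow_left₀ (by positivity) h1 j
    rw [← Real.exp_nat_mul, div_pow, div_le_iff₀ (by positivity)] at h2
    have e : (j : ℝ) * (t / j - 1) = t - j := by field_simp
    rw [e] at h2
    linarith
  set s : ℝ := ((k + l : ℕ) : ℝ) with hs
  have hs0 : 0 ≤ s := Nat.cast_nonneg _
  calc b ^ k * c ^ l * s ^ (k + l) = (b * s) ^ k * (c * s) ^ l := by ring
    _ ≤ ((k : ℝ) ^ k * Real.exp (b * s - k)) * ((l : ℝ) ^ l * Real.exp (c * s - l)) := by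
      gcongr
      · exact key _ _ (by positivity)
      · exact key _ _ (by positivity)
    _ = (k : ℝ) ^ k * (l : ℝ) ^ l * Real.exp ((b * s - k) + (c * s - l)) := by
      rw [Real.exp_add]; ring
    _ = _ := by
      have : (b * s - k) + (c * s - l) = 0 := by
        have : b * s + c * s = s := by rw [← add_mul, hbc, one_mul]
        rw [hs] at *
        push_cast at *
        linarith
      rw [this]; simp

/-- The Bernoulli likelihood is at most the regret-inflated Krichevsky–Trofimov weight. -/
lemma pow_mul_pow_mul_halfRising_le {b c : ℝ} (hb : 0 ≤ b) (hc : 0 ≤ c) (hbc : b + c = 1)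
    (k l : ℕ) : b ^ k * c ^ l * halfRising (k + l) ≤ halfRising k * halfRising l := by
  have h1 := pow_mul_pow_le_pow_self hb hc hbc k l
  have h2 := pow_self_mul_halfRising_le k l
  have hs : (0 : ℝ) < ((k + l : ℕ) : ℝ) ^ (k + l) := by
    rcases Nat.eq_zero_or_pos (k + l) with h | h
    · rw [h]; simp
    · exact pow_pos (by exact_mod_cast h) _
  refine le_of_mul_le_mul_left ?_ hs
  have h3 := mul_le_mul_of_nonneg_right h1 (halfRising_pos (k + l)).le
  linarith

/-- The Krichevsky–Trofimov weight of `k` successes and `l` failures. -/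
def ktWeight (k l : ℕ) : ℝ := halfRising k * halfRising l / ((k + l).factorial : ℝ)

lemma ktWeight_nonneg (k l : ℕ) : 0 ≤ ktWeight k l :=
  div_nonneg (mul_nonneg (halfRising_pos k).le (halfRising_pos l).le) (Nat.cast_nonneg _)

/-- The predictive probabilities `(k + 1/2)/(k + l + 1)` and `(l + 1/2)/(k + l + 1)` sum to one. -/
lemma ktWeight_add (k l : ℕ) : ktWeight (k + 1) l + ktWeight k (l + 1) = ktWeight k l := by
  have hf : ((k + l).factorial : ℝ) ≠ 0 := by exact_mod_cast (k + l).factorial_ne_zero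
  have e1 : k + 1 + l = k + l + 1 := by omega
  have e2 : k + (l + 1) = k + l + 1 := by omega
  rw [ktWeight, ktWeight, ktWeight, e1, e2, Nat.factorial_succ, halfRising_succ, halfRising_succ]
  push_cast
  field_simp
  ring

/-- The counts `k`, `l` of past outcomes are kept general so that the induction can add one element
to either side. At `k = l = 0` the weights form a probability distribution on subsets. -/
lemma sum_powerset_ktWeight {ι : Type*} [DecidableEq ι] (s : Finset ι) (k l : ℕ) :
    ∑ t ∈ s.powerset, ktWeight (k + t.card) (l + (s \ t).card) = ktWeight k l := by
  induction s using Finset.induction_on generalizing k l with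
  | empty => simp
  | insert a s ha ih =>
    rw [Finset.sum_powerset_insert ha, ← ktWeight_add k l, ← ih (k + 1) l, ← ih k (l + 1), add_comm]
    congr 1
    · refine Finset.sum_congr rfl fun t ht => ?_
      have hat : a ∉ t := fun h => ha (Finset.mem_powerset.1 ht h)
      rw [Finset.card_insert_of_notMem hat, Finset.insert_sdiff_insert,
        Finset.sdiff_insert_of_notMem ha]
      congr 1
      omega
    · refine Finset.sum_congr rfl fun t ht => ?_
      have hat : a ∉ t := fun h => ha (Finset.mem_powerset.1 ht h)
      rw [Finset.insert_sdiff_of_notMem _ hat, Finset.card_insert_of_notMem (by simp [ha])]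
      congr 1
      omega

lemma pow_mul_pow_le_regret_mul_ktWeight {b c : ℝ} (hb : 0 ≤ b) (hc : 0 ≤ c) (hbc : b + c = 1)
    (k l : ℕ) : b ^ k * c ^ l ≤ regret (k + l) * ktWeight k l := by
  have hf : ((k + l).factorial : ℝ) ≠ 0 := by exact_mod_cast (k + l).factorial_ne_zero
  have h := halfRising_pos (k + l)
  have e : regret (k + l) * ktWeight k l = halfRising k * halfRising l / halfRising (k + l) := by
    rw [regret, ktWeight]; field_simp
  rw [e, le_div_iff₀ h]
  exact pow_mul_pow_mul_halfRising_le hb hc hbc k l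

/-! ### The Krichevsky–Trofimov wealth -/

/-- The wealth of the Krichevsky–Trofimov mixture of bets on the outcomes `y` against the mean `ν`.
For `ν ∈ {0, 1}` the conventions of `ℝ≥0∞` make it infinite as soon as some outcome differs
from `ν`. -/
def ktWealth {n : ℕ} (ν : ℝ) (y : Fin n → ℝ) : ENNReal :=
  ∑ t ∈ (Finset.univ : Finset (Fin n)).powerset,
    ENNReal.ofReal (ktWeight t.card (Finset.univ \ t).card) *
      ((∏ i ∈ t, ENNReal.ofReal (y i) / ENNReal.ofReal ν) *
        ∏ i ∈ Finset.univ \ t, ENNReal.ofReal (1 - y i) / ENNReal.ofReal (1 - ν))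

lemma measurable_ktWealth {α : Type*} [MeasurableSpace α] {n : ℕ} {ν : α → ℝ} {y : α → Fin n → ℝ}
    (hν : Measurable ν) (hy : ∀ i, Measurable fun a => y a i) :
    Measurable fun a => ktWealth (ν a) (y a) := by
  unfold ktWealth
  fun_prop

/-- The numbers `ν A` and `(1 - ν) B` form a Bernoulli pair, so its likelihood is covered by the
Krichevsky–Trofimov weight. Dividing by `ν^k (1 - ν)^l` leaves the claim. -/
lemma ofReal_pow_mul_pow_le {ν A B : ℝ} (hν0 : 0 ≤ ν) (hν1 : ν ≤ 1) (hA : 0 ≤ A) (hB : 0 ≤ B)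
    (h : ν * A + (1 - ν) * B = 1) (k l : ℕ) :
    ENNReal.ofReal (A ^ k * B ^ l) ≤ ENNReal.ofReal (regret (k + l)) *
      (ENNReal.ofReal (ktWeight k l) *
        ((ENNReal.ofReal ν)⁻¹ ^ k * (ENNReal.ofReal (1 - ν))⁻¹ ^ l)) := by
  have hv : 0 ≤ 1 - ν := by linarith
  -- Strict positivity covers `ν ∈ {0, 1}`: division by zero in `ℝ≥0∞` gives `⊤` only for a nonzero
  -- numerator.
  have hc : 0 < regret (k + l) * ktWeight k l := by
    have h1 := halfRising_pos k
    have h2 := halfRising_pos l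
    have : 0 < ktWeight k l :=
      div_pos (mul_pos h1 h2) (by exact_mod_cast (k + l).factorial_pos)
    exact mul_pos (regret_pos _) this
  rw [← mul_assoc, ← ENNReal.ofReal_mul (regret_pos _).le, ← ENNReal.inv_pow, ← ENNReal.inv_pow,
    ← ENNReal.mul_inv (Or.inr (by finiteness)) (Or.inl (by finiteness)), ← div_eq_mul_inv,
    ENNReal.le_div_iff_mul_le (Or.inr (by simpa using hc)) (Or.inr (by finiteness)),
    ← ENNReal.ofReal_pow hν0, ← ENNReal.ofReal_pow hv, ← ENNReal.ofReal_mul (by positivity),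
    ← ENNReal.ofReal_mul (by positivity)]
  refine ENNReal.ofReal_le_ofReal ?_
  refine le_trans (le_of_eq ?_)
    (pow_mul_pow_le_regret_mul_ktWeight (mul_nonneg hν0 hA) (mul_nonneg hv hB) h k l)
  rw [mul_pow, mul_pow]
  ring

/-- Each factor is the interpolation `y A + (1 - y) B` of the payoffs at outcomes 1 and 0, which are
nonnegative exactly when the bet is admissible. Expanding the product over subsets reduces the claim
to the monomials `A^k B^l`. -/
lemma ofReal_prod_le_regret_mul_ktWealth {n : ℕ} {ν : ℝ} (hν : ν ∈ Set.Icc (0 : ℝ) 1)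
    {y : Fin n → ℝ} (hy : ∀ i, y i ∈ Set.Icc (0 : ℝ) 1) {l : ℝ} (hl : l ∈ admissibleBets ν) :
    ENNReal.ofReal (∏ i, (1 + l * (y i - ν))) ≤ ENNReal.ofReal (regret n) * ktWealth ν y := by
  set A : ℝ := 1 + l * (1 - ν) with hA
  set B : ℝ := 1 - l * ν with hB
  have hA0 : 0 ≤ A := by have := hl.1; rw [hA]; linarith
  have hB0 : 0 ≤ B := by have := hl.2; rw [hB]; linarith
  have hAB : ν * A + (1 - ν) * B = 1 := by rw [hA, hB]; ring
  have hexp : ∏ i, (1 + l * (y i - ν)) = ∑ t ∈ (Finset.univ : Finset (Fin n)).powerset,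
      (∏ i ∈ t, y i) * (∏ i ∈ Finset.univ \ t, (1 - y i)) *
        (A ^ t.card * B ^ (Finset.univ \ t).card) := by
    have : ∀ i, 1 + l * (y i - ν) = y i * A + (1 - y i) * B := by intro i; rw [hA, hB]; ring
    simp_rw [this]
    rw [Finset.prod_add]
    refine Finset.sum_congr rfl fun t _ => ?_
    rw [Finset.prod_mul_distrib, Finset.prod_mul_distrib, Finset.prod_const, Finset.prod_const]
    ring
  have hp : ∀ t : Finset (Fin n), 0 ≤ (∏ i ∈ t, y i) :=
    fun t => Finset.prod_nonneg fun i _ => (hy i).1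
  have hq : ∀ t : Finset (Fin n), 0 ≤ (∏ i ∈ t, (1 - y i)) :=
    fun t => Finset.prod_nonneg fun i _ => sub_nonneg.2 (hy i).2
  rw [hexp, ENNReal.ofReal_sum_of_nonneg fun t _ => by
    have := hp t
    have := hq (Finset.univ \ t)
    positivity, ktWealth, Finset.mul_sum]
  refine Finset.sum_le_sum fun t _ => ?_
  have hcard : t.card + (Finset.univ \ t).card = n := by
    rw [Finset.card_sdiff_of_subset (Finset.subset_univ t), Finset.card_univ, Fintype.card_fin]
    have := Finset.card_le_univ t
    rw [Fintype.card_fin] at this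
    omega
  have h := ofReal_pow_mul_pow_le hν.1 hν.2 hA0 hB0 hAB t.card (Finset.univ \ t).card
  rw [hcard] at h
  rw [ENNReal.ofReal_mul (mul_nonneg (hp _) (hq _)), ENNReal.ofReal_mul (hp _),
    ENNReal.ofReal_prod_of_nonneg fun i _ => (hy i).1,
    ENNReal.ofReal_prod_of_nonneg fun i _ => sub_nonneg.2 (hy i).2]
  refine (mul_le_mul_right h _).trans (le_of_eq ?_)
  simp_rw [div_eq_mul_inv, Finset.prod_mul_distrib, Finset.prod_const]
  ring

lemma one_le_regret_mul_ktWealth {n : ℕ} {ν : ℝ} (hν : ν ∈ Set.Icc (0 : ℝ) 1)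
    {y : Fin n → ℝ} (hy : ∀ i, y i ∈ Set.Icc (0 : ℝ) 1) :
    1 ≤ ENNReal.ofReal (regret n) * ktWealth ν y := by
  simpa using ofReal_prod_le_regret_mul_ktWealth hν hy (l := 0) (by simp [admissibleBets])

lemma optLogWealth_le_log {Θ 𝒳 : Type*} {f : Θ → 𝒳 → ℝ} (hf01 : ∀ θ x, f θ x ∈ Set.Icc (0 : ℝ) 1)
    {n : ℕ} (x : Fin n → 𝒳) (θ : Θ) {ν : ℝ} (hν : ν ∈ Set.Icc (0 : ℝ) 1) :
    optLogWealth f x θ ν ≤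
      ENNReal.log (ENNReal.ofReal (regret n) * ktWealth ν fun i => f θ (x i)) := by
  refine iSup₂_le fun l hl => ?_
  have hsum : ∀ (s : Finset (Fin n)) (a : Fin n → ENNReal),
      ∑ i ∈ s, ENNReal.log (a i) = ENNReal.log (∏ i ∈ s, a i) := by
    intro s a
    induction s using Finset.induction_on with
    | empty => simp
    | insert i s hi ih => rw [Finset.sum_insert hi, Finset.prod_insert hi, ih, ENNReal.log_mul_add]
  have hpos : ∀ i, 0 ≤ 1 + l * (f θ (x i) - ν) := by
    intro i
    have h0 := (hf01 θ (x i)).1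
    have h1 := (hf01 θ (x i)).2
    have e : 1 + l * (f θ (x i) - ν) =
      f θ (x i) * (1 + l * (1 - ν)) + (1 - f θ (x i)) * (1 - l * ν) := by ring
    rw [e]
    have hA : 0 ≤ 1 + l * (1 - ν) := by linarith [hl.1]
    have hB : 0 ≤ 1 - l * ν := by linarith [hl.2]
    have := sub_nonneg.2 h1
    positivity
  rw [hsum, ← ENNReal.ofReal_prod_of_nonneg fun i _ => hpos i]
  exact ENNReal.log_le_log (ofReal_prod_le_regret_mul_ktWealth hν (fun i => hf01 θ (x i)) hl)

lemma lintegral_pi_prod {n : ℕ} {𝒳 : Type*} [MeasurableSpace 𝒳] (D : Measure 𝒳)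
    [IsProbabilityMeasure D] {g : Fin n → 𝒳 → ENNReal} (hg : ∀ i, Measurable (g i)) :
    ∫⁻ x, ∏ i, g i (x i) ∂(Measure.pi fun _ : Fin n => D) = ∏ i, ∫⁻ a, g i a ∂D := by
  have hind : iIndepFun (fun i (x : Fin n → 𝒳) => g i (x i)) (Measure.pi fun _ : Fin n => D) :=
    iIndepFun_pi (μ := fun _ : Fin n => D) (X := g) fun i => (hg i).aemeasurable
  rw [lintegral_prod_eq_prod_lintegral_of_indepFun Finset.univ _ hind
    fun i => (hg i).comp (measurable_pi_apply i)]
  refine Finset.prod_congr rfl fun i _ => ?_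
  exact (measurePreserving_eval (fun _ : Fin n => D) i).lintegral_comp (hg i)

/-- Each factor `g/ν` or `(1 - g)/(1 - ν)` has mean at most one (zero in the case `0/0`),
independence multiplies these means, and the weights sum to one. -/
lemma lintegral_ktWealth_le_one {n : ℕ} {𝒳 : Type*} [MeasurableSpace 𝒳] (D : Measure 𝒳)
    [IsProbabilityMeasure D] {g : 𝒳 → ℝ} (hg : Measurable g)
    (hg01 : ∀ x, g x ∈ Set.Icc (0 : ℝ) 1) :
    ∫⁻ x, ktWealth (∫ a, g a ∂D) (fun i => g (x i)) ∂(Measure.pi fun _ : Fin n => D) ≤ 1 := by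
  have hint : Integrable g D := by
    refine Integrable.of_bound hg.aestronglyMeasurable 1 (Filter.Eventually.of_forall fun x => ?_)
    rw [Real.norm_eq_abs, abs_of_nonneg (hg01 x).1]
    exact (hg01 x).2
  have hint' : Integrable (fun a => 1 - g a) D := (integrable_const 1).sub hint
  set ν : ℝ := ∫ a, g a ∂D with hν
  have h1 : ∫⁻ a, ENNReal.ofReal (g a) / ENNReal.ofReal ν ∂D ≤ 1 := by
    simp_rw [div_eq_mul_inv]
    rw [lintegral_mul_const _ (by fun_prop), ← ofReal_integral_eq_lintegral_ofReal hint
      (Filter.Eventually.of_forall fun x => (hg01 x).1), ← hν, ← div_eq_mul_inv]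
    exact ENNReal.div_self_le_one
  have h2 : ∫⁻ a, ENNReal.ofReal (1 - g a) / ENNReal.ofReal (1 - ν) ∂D ≤ 1 := by
    simp_rw [div_eq_mul_inv]
    rw [lintegral_mul_const _ (by fun_prop), ← ofReal_integral_eq_lintegral_ofReal hint'
      (Filter.Eventually.of_forall fun x => sub_nonneg.2 (hg01 x).2),
      integral_sub (integrable_const 1) hint, ← hν, ← div_eq_mul_inv]
    simp [ENNReal.div_self_le_one]
  unfold ktWealth
  rw [lintegral_finsetSum _ fun t _ => by fun_prop]
  have hterm : ∀ t ∈ (Finset.univ : Finset (Fin n)).powerset,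
      ∫⁻ x, ENNReal.ofReal (ktWeight t.card (Finset.univ \ t).card) *
      ((∏ i ∈ t, ENNReal.ofReal (g (x i)) / ENNReal.ofReal ν) *
        ∏ i ∈ Finset.univ \ t, ENNReal.ofReal (1 - g (x i)) / ENNReal.ofReal (1 - ν))
          ∂(Measure.pi fun _ : Fin n => D) ≤
        ENNReal.ofReal (ktWeight t.card (Finset.univ \ t).card) := by
    intro t _
    rw [lintegral_const_mul _ (by fun_prop)]
    refine mul_le_of_le_one_right' ?_
    set G : Fin n → 𝒳 → ENNReal := fun i a =>
      if i ∈ t then ENNReal.ofReal (g a) / ENNReal.ofReal ν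
      else ENNReal.ofReal (1 - g a) / ENNReal.ofReal (1 - ν) with hG
    have hGm : ∀ i, Measurable (G i) := by
      intro i
      by_cases hi : i ∈ t
      · simp only [hG, hi, if_true]; fun_prop
      · simp only [hG, hi, if_false]; fun_prop
    have hprod : ∀ x : Fin n → 𝒳, (∏ i ∈ t, ENNReal.ofReal (g (x i)) / ENNReal.ofReal ν) *
        ∏ i ∈ Finset.univ \ t, ENNReal.ofReal (1 - g (x i)) / ENNReal.ofReal (1 - ν) =
          ∏ i, G i (x i) := by
      intro x
      rw [← Finset.prod_sdiff (Finset.subset_univ t), mul_comm]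
      congr 1
      · refine Finset.prod_congr rfl fun i hi => ?_
        simp [hG, (Finset.mem_sdiff.1 hi).2]
      · refine Finset.prod_congr rfl fun i hi => ?_
        simp [hG, hi]
    simp_rw [hprod]
    rw [lintegral_pi_prod D hGm]
    refine Finset.prod_le_one' fun i _ => ?_
    by_cases hi : i ∈ t
    · simpa only [hG, hi, if_true] using h1
    · simpa only [hG, hi, if_false] using h2
  refine (Finset.sum_le_sum hterm).trans ?_
  rw [← ENNReal.ofReal_sum_of_nonneg fun t _ => ktWeight_nonneg _ _]
  have := sum_powerset_ktWeight (Finset.univ : Finset (Fin n)) 0 0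
  simp only [zero_add] at this
  rw [this]
  simp [ktWeight, halfRising_zero]

attribute [irreducible] ktWealth

/-! ### The Donsker–Varadhan inequality -/

/-- The positive part of the logarithm on `ℝ≥0∞`. -/
def posLog (z : ENNReal) : ENNReal := (ENNReal.log z).toENNReal

@[fun_prop]
lemma measurable_posLog : Measurable posLog :=
  measurable_ereal_toENNReal.comp ENNReal.measurable_log

lemma posLog_mul_le (y z : ENNReal) : posLog (y * z) ≤ posLog y + posLog z := by
  rw [posLog, ENNReal.log_mul_add]
  exact EReal.toENNReal_add_le

lemma posLog_ofReal {x : ℝ} (hx : 0 < x) : posLog (ENNReal.ofReal x) = ENNReal.ofReal (Real.log x) := by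
  rw [posLog, ENNReal.log_ofReal_of_pos hx, EReal.real_coe_toENNReal]

lemma posLog_zero : posLog 0 = 0 := by simp [posLog]

lemma posLog_top : posLog ⊤ = ⊤ := by simp [posLog]

lemma log_le_posLog (z : ENNReal) : ENNReal.log z ≤ (posLog z : EReal) := by
  rw [posLog, EReal.coe_toENNReal_eq_max]
  exact le_max_right _ _

/-- Fenchel–Young: the convex conjugate of `klFun` is `exp z - 1`. -/
lemma mul_le_klFun_add_exp {q z : ℝ} (hq : 0 ≤ q) :
    q * z + 1 ≤ InformationTheory.klFun q + Real.exp z := by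
  rw [InformationTheory.klFun_apply]
  rcases hq.eq_or_lt with rfl | hq
  · simp; positivity
  have h : Real.log (Real.exp z / q) ≤ Real.exp z / q - 1 :=
    Real.log_le_sub_one_of_pos (by positivity)
  rw [Real.log_div (by positivity) hq.ne', Real.log_exp] at h
  have h2 := mul_le_mul_of_nonneg_left h hq.le
  have e : q * (Real.exp z / q - 1) = Real.exp z - q := by field_simp
  rw [e] at h2
  linarith

/-- Fenchel–Young at `z = log (y / M)`, with terms moved so that no subtraction occurs in `ℝ≥0∞`.
When `M` is the prior integral of `y`, integration turns `y / M` into one, which cancels the added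
one. -/
lemma mul_posLog_add_one_le {q : ENNReal} (hq : q ≠ ⊤) {y : ENNReal} (hy : 1 ≤ y) {M : ℝ}
    (hM : 1 ≤ M) :
    q * posLog y + 1 ≤ ENNReal.ofReal (InformationTheory.klFun q.toReal) + y / ENNReal.ofReal M +
      q * ENNReal.ofReal (Real.log M) := by
  have hM0 : 0 < M := by linarith
  rcases eq_or_ne y ⊤ with rfl | hyt
  · rw [ENNReal.top_div_of_ne_top (by finiteness)]
    simp
  obtain ⟨y, rfl⟩ : ∃ r : ℝ, y = ENNReal.ofReal r := ⟨y.toReal, (ENNReal.ofReal_toReal hyt).symm⟩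
  obtain ⟨q, hq0, rfl⟩ : ∃ r : ℝ, 0 ≤ r ∧ q = ENNReal.ofReal r :=
    ⟨q.toReal, ENNReal.toReal_nonneg, (ENNReal.ofReal_toReal hq).symm⟩
  have hy1 : 1 ≤ y := by simpa using hy
  have hy0 : 0 < y := by linarith
  have hk := InformationTheory.klFun_nonneg hq0
  have hl := Real.log_nonneg hy1
  have hlM := Real.log_nonneg hM
  rw [posLog_ofReal hy0, ENNReal.toReal_ofReal hq0, ← ENNReal.ofReal_mul hq0,
    ← ENNReal.ofReal_mul hq0, ← ENNReal.ofReal_div_of_pos hM0, ← ENNReal.ofReal_one,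
    ← ENNReal.ofReal_add (by positivity) zero_le_one, ← ENNReal.ofReal_add hk (by positivity),
    ← ENNReal.ofReal_add (by positivity) (by positivity)]
  refine ENNReal.ofReal_le_ofReal ?_
  have h := mul_le_klFun_add_exp (z := Real.log (y / M)) hq0
  rw [Real.exp_log (by positivity), Real.log_div hy0.ne' hM0.ne'] at h
  linarith

/-- The Donsker–Varadhan inequality for the logarithm of a function with values in `[1, ∞]`. -/
lemma lintegral_posLog_le {Θ : Type*} [MeasurableSpace Θ] (Q P₀ : Measure Θ)
    [IsProbabilityMeasure Q] [IsProbabilityMeasure P₀] {V : Θ → ENNReal} (hV : Measurable V)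
    (hV1 : ∀ θ, 1 ≤ V θ) :
    ∫⁻ θ, posLog (V θ) ∂Q ≤ InformationTheory.klDiv Q P₀ + posLog (∫⁻ θ, V θ ∂P₀) := by
  by_cases hac : Q ≪ P₀
  swap
  · simp [InformationTheory.klDiv_of_not_ac hac]
  rcases eq_or_ne (∫⁻ θ, V θ ∂P₀) ⊤ with hM | hM
  · simp [hM, posLog_top]
  have hM1 : 1 ≤ ∫⁻ θ, V θ ∂P₀ := by
    calc (1 : ENNReal) = ∫⁻ _, 1 ∂P₀ := by simp
      _ ≤ _ := lintegral_mono hV1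
  obtain ⟨M, hMr⟩ : ∃ r : ℝ, ∫⁻ θ, V θ ∂P₀ = ENNReal.ofReal r :=
    ⟨_, (ENNReal.ofReal_toReal hM).symm⟩
  rw [hMr] at hM1 ⊢
  have hM1' : 1 ≤ M := by simpa using hM1
  have hM0 : 0 < M := by linarith
  rw [posLog_ofReal hM0]
  have hq := Measure.measurable_rnDeriv Q P₀
  have hQ : ∫⁻ θ, posLog (V θ) ∂Q = ∫⁻ θ, Q.rnDeriv P₀ θ * posLog (V θ) ∂P₀ :=
    (lintegral_rnDeriv_mul hac (measurable_posLog.comp hV).aemeasurable).symm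
  have hq1 : ∫⁻ θ, Q.rnDeriv P₀ θ ∂P₀ = 1 := by
    rw [Measure.lintegral_rnDeriv hac, measure_univ]
  have hle : ∫⁻ θ, (Q.rnDeriv P₀ θ * posLog (V θ) + 1) ∂P₀ ≤
      ∫⁻ θ, (ENNReal.ofReal (InformationTheory.klFun (Q.rnDeriv P₀ θ).toReal) +
        V θ / ENNReal.ofReal M + Q.rnDeriv P₀ θ * ENNReal.ofReal (Real.log M)) ∂P₀ := by
    refine lintegral_mono_ae ?_
    filter_upwards [Measure.rnDeriv_ne_top Q P₀] with θ hθ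
    exact mul_posLog_add_one_le hθ (hV1 θ) hM1'
  have hkl : Measurable InformationTheory.klFun := InformationTheory.measurable_klFun
  rw [lintegral_add_right _ measurable_const, lintegral_add_left (by fun_prop),
    lintegral_add_left (by fun_prop), lintegral_mul_const _ hq, hq1,
    ← InformationTheory.klDiv_eq_lintegral_klFun_of_ac hac, ← hQ] at hle
  simp_rw [div_eq_mul_inv] at hle
  rw [lintegral_mul_const _ hV, hMr, ENNReal.mul_inv_cancel (by simpa using hM0) (by finiteness)]
    at hle
  simp only [lintegral_const, measure_univ, mul_one, one_mul] at hle
  rw [add_right_comm] at hle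
  exact (ENNReal.add_le_add_iff_right ENNReal.one_ne_top).1 hle

attribute [irreducible] posLog

/-! ### The binary relative entropy and its Chernoff bound -/

/-- The finite form of the binary relative entropy, for a second argument in `(0, 1)`. -/
def binaryKLReal (q p : ℝ) : ℝ :=
  -Real.binEntropy p - p * Real.log q - (1 - p) * Real.log (1 - q)

lemma binaryKL_eq_coe {p q : ℝ} (hq0 : 0 < q) (hq1 : q < 1) :
    binaryKL p q = (binaryKLReal q p : EReal) := by
  have h : ¬((q = 0 ∧ p ≠ 0) ∨ (q = 1 ∧ p ≠ 1)) := by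
    rintro (h | h)
    · exact hq0.ne' h.1
    · exact hq1.ne h.1
  have key : ∀ a b : ℝ, b ≠ 0 → a * Real.log (a / b) = a * Real.log a - a * Real.log b := by
    intro a b hb
    rcases eq_or_ne a 0 with rfl | ha
    · simp
    · rw [Real.log_div ha hb]; ring
  rw [binaryKL, if_neg h, key _ _ hq0.ne', key _ _ (sub_pos.2 hq1).ne',
    binaryKLReal, Real.binEntropy, Real.log_inv, Real.log_inv]
  congr 1
  ring

lemma binaryKL_self {p : ℝ} : binaryKL p p = 0 := by
  have h : ¬((p = 0 ∧ p ≠ 0) ∨ (p = 1 ∧ p ≠ 1)) := by tauto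
  rw [binaryKL, if_neg h]
  have key : ∀ a : ℝ, a * Real.log (a / a) = 0 := by
    intro a
    rcases eq_or_ne a 0 with rfl | ha
    · simp
    · rw [div_self ha]; simp
  rw [key, key]
  simp

lemma binaryKL_one_sub (p q : ℝ) : binaryKL (1 - p) (1 - q) = binaryKL p q := by
  have h : ((1 - q = 0 ∧ 1 - p ≠ 0) ∨ (1 - q = 1 ∧ 1 - p ≠ 1)) ↔
      ((q = 0 ∧ p ≠ 0) ∨ (q = 1 ∧ p ≠ 1)) := by
    have e1 : 1 - q = 0 ↔ q = 1 := by constructor <;> intro h <;> linarith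
    have e2 : 1 - p = 0 ↔ p = 1 := by constructor <;> intro h <;> linarith
    have e3 : 1 - q = 1 ↔ q = 0 := by constructor <;> intro h <;> linarith
    have e4 : 1 - p = 1 ↔ p = 0 := by constructor <;> intro h <;> linarith
    rw [Ne, Ne, e1, e2, e3, e4]
    tauto
  rw [binaryKL, binaryKL]
  by_cases hc : (q = 0 ∧ p ≠ 0) ∨ (q = 1 ∧ p ≠ 1)
  · rw [if_pos hc, if_pos (h.2 hc)]
  · rw [if_neg hc, if_neg fun h' => hc (h.1 h'), sub_sub_cancel, sub_sub_cancel, add_comm]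

lemma measurable_binaryKL {α : Type*} [MeasurableSpace α] {p q : α → ℝ} (hp : Measurable p)
    (hq : Measurable q) : Measurable fun a => binaryKL (p a) (q a) := by
  unfold binaryKL
  have hs : ∀ {r : α → ℝ} (_ : Measurable r) (c : ℝ), MeasurableSet {a | r a = c} :=
    fun hr c => hr (measurableSet_singleton c)
  refine Measurable.ite ?_ measurable_const (by fun_prop)
  exact ((hs hq 0).inter (hs hp 0).compl).union ((hs hq 1).inter (hs hp 1).compl)

lemma continuous_binaryKLReal (q : ℝ) : Continuous (binaryKLReal q) := by
  unfold binaryKLReal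
  have := Real.binEntropy_continuous
  fun_prop

lemma binaryKLReal_antitoneOn {q : ℝ} (hq1 : q < 1) :
    AntitoneOn (binaryKLReal q) (Set.Icc 0 q) := by
  have hd : ∀ p ∈ interior (Set.Icc 0 q), HasDerivAt (binaryKLReal q)
      (-(Real.log (1 - p) - Real.log p) - Real.log q + Real.log (1 - q)) p := by
    intro p hp
    rw [interior_Icc] at hp
    have h1 := Real.hasDerivAt_binEntropy hp.1.ne' (by linarith [hp.2] : p < 1).ne
    have h2 : HasDerivAt (fun p : ℝ => p * Real.log q) (Real.log q) p := by
      simpa using (hasDerivAt_id p).mul_const (Real.log q)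
    have h3 : HasDerivAt (fun p : ℝ => (1 - p) * Real.log (1 - q)) (-Real.log (1 - q)) p := by
      simpa using ((hasDerivAt_id p).const_sub 1).mul_const (Real.log (1 - q))
    exact ((h1.neg.sub h2).sub h3).congr_deriv (by ring)
  refine antitoneOn_of_deriv_nonpos (convex_Icc 0 q) (continuous_binaryKLReal q).continuousOn
    (fun p hp => (hd p hp).differentiableAt.differentiableWithinAt) fun p hp => ?_
  rw [(hd p hp).deriv]
  rw [interior_Icc] at hp
  have h1 := Real.log_le_log hp.1 hp.2.le
  have h2 := Real.log_le_log (sub_pos.2 hq1) (by linarith [hp.2] : 1 - q ≤ 1 - p)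
  linarith

lemma binaryKLReal_self (q : ℝ) : binaryKLReal q q = 0 := by
  rw [binaryKLReal, Real.binEntropy, Real.log_inv, Real.log_inv]
  ring

lemma binaryKL_anti {p p' q : ℝ} (hp : 0 ≤ p) (hpp : p ≤ p') (hpq : p' ≤ q) (hq : q ≤ 1) :
    binaryKL p' q ≤ binaryKL p q := by
  rcases (hp.trans (hpp.trans hpq)).eq_or_lt with rfl | hq0
  · have : p = p' := by linarith
    rw [this]
  rcases hq.eq_or_lt with rfl | hq1
  · rcases eq_or_ne p 1 with rfl | h
    · have : p' = 1 := by linarith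
      rw [this]
    · have : binaryKL p 1 = ⊤ := by rw [binaryKL, if_pos (Or.inr ⟨rfl, h⟩)]
      rw [this]
      exact le_top
  · rw [binaryKL_eq_coe hq0 hq1, binaryKL_eq_coe hq0 hq1]
    exact_mod_cast binaryKLReal_antitoneOn hq1 ⟨hp, hpp.trans hpq⟩ ⟨hp.trans hpp, hpq⟩ hpp

/-! ### Exponential moments and the Chernoff bound for block averages -/

lemma exp_mul_le_chord {h : ℝ} (h0 : 0 ≤ h) (h1 : h ≤ 1) (l : ℝ) :
    Real.exp (l * h) ≤ 1 - h + h * Real.exp l := by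
  have := convexOn_exp.2 (Set.mem_univ (0 : ℝ)) (Set.mem_univ l) (sub_nonneg.2 h1) h0
    (by ring : 1 - h + h = 1)
  simpa [mul_comm] using this

/-- The exponent is the minimizer of the Bernoulli Chernoff bound; at this value the bound equals
the exponential of minus the relative entropy. -/
lemma chord_mul_exp_eq {q v : ℝ} (hq0 : 0 < q) (hq1 : q < 1) (hv0 : 0 < v) (hv1 : v < 1) :
    (1 - q + q * Real.exp (Real.log (v * (1 - q) / ((1 - v) * q)))) *
      Real.exp (-(Real.log (v * (1 - q) / ((1 - v) * q)) * v)) = Real.exp (-binaryKLReal q v) := by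
  have hq1' := sub_pos.2 hq1
  have hv1' := sub_pos.2 hv1
  have e : 1 - q + q * Real.exp (Real.log (v * (1 - q) / ((1 - v) * q))) =
      Real.exp (Real.log (1 - q) - Real.log (1 - v)) := by
    rw [Real.exp_log (by positivity), Real.exp_sub, Real.exp_log hq1', Real.exp_log hv1']
    field_simp
    ring
  rw [e, ← Real.exp_add, Real.log_div (by positivity) (by positivity),
    Real.log_mul hv0.ne' hq1'.ne', Real.log_mul hv1'.ne' hq0.ne', binaryKLReal, Real.binEntropy,
    Real.log_inv, Real.log_inv]
  congr 1
  ring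

/-- The average of `h` over a block. -/
def blockMean {Θ : Type*} {m : ℕ} (h : Θ → ℝ) (θ : Fin m → Θ) : ℝ := 1 / (m : ℝ) * ∑ i, h (θ i)

lemma blockMean_mem_Icc {Θ : Type*} {m : ℕ} (hm : 0 < m) {h : Θ → ℝ}
    (h01 : ∀ θ, h θ ∈ Set.Icc (0 : ℝ) 1) (θ : Fin m → Θ) :
    blockMean h θ ∈ Set.Icc (0 : ℝ) 1 := by
  have hm' : (0 : ℝ) < m := by exact_mod_cast hm
  refine ⟨mul_nonneg (by positivity) (Finset.sum_nonneg fun i _ => (h01 _).1), ?_⟩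
  have : ∑ i, h (θ i) ≤ ∑ _i : Fin m, (1 : ℝ) := Finset.sum_le_sum fun i _ => (h01 (θ i)).2
  rw [Finset.sum_const, Finset.card_univ, Fintype.card_fin, nsmul_eq_mul, mul_one] at this
  rw [blockMean, one_div, inv_mul_le_iff₀ hm', mul_one]
  exact this

lemma blockMean_one_sub {Θ : Type*} {m : ℕ} (hm : 0 < m) (h : Θ → ℝ) (θ : Fin m → Θ) :
    blockMean (fun t => 1 - h t) θ = 1 - blockMean h θ := by
  have hm' : (m : ℝ) ≠ 0 := by exact_mod_cast hm.ne'
  rw [blockMean, blockMean, Finset.sum_sub_distrib]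
  simp only [Finset.sum_const, Finset.card_univ, Fintype.card_fin, nsmul_eq_mul, mul_one]
  field_simp

lemma integrable_of_mem_Icc {Θ : Type*} [MeasurableSpace Θ] (Q : Measure Θ)
    [IsProbabilityMeasure Q] {h : Θ → ℝ} (hh : Measurable h)
    (h01 : ∀ θ, h θ ∈ Set.Icc (0 : ℝ) 1) : Integrable h Q := by
  refine Integrable.of_bound hh.aestronglyMeasurable 1 (Filter.Eventually.of_forall fun x => ?_)
  rw [Real.norm_eq_abs, abs_of_nonneg (h01 x).1]
  exact (h01 x).2

lemma integral_mem_Icc {Θ : Type*} [MeasurableSpace Θ] (Q : Measure Θ)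
    [IsProbabilityMeasure Q] {h : Θ → ℝ} (hh : Measurable h)
    (h01 : ∀ θ, h θ ∈ Set.Icc (0 : ℝ) 1) : ∫ t, h t ∂Q ∈ Set.Icc (0 : ℝ) 1 := by
  refine ⟨integral_nonneg fun t => (h01 t).1, ?_⟩
  have := integral_mono (integrable_of_mem_Icc Q hh h01) (integrable_const (1 : ℝ))
    fun t => (h01 t).2
  simpa using this

/-- By convexity of the exponential, the moment generating function of a `[0,1]`-valued variable is
at most that of a Bernoulli variable with the same mean. -/
lemma measure_blockMean_le {Θ : Type*} [MeasurableSpace Θ] (Q : Measure Θ)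
    [IsProbabilityMeasure Q] {h : Θ → ℝ} (hh : Measurable h)
    (h01 : ∀ θ, h θ ∈ Set.Icc (0 : ℝ) 1) {m : ℕ} (hm : 0 < m) {v : ℝ} (hv0 : 0 < v)
    (hvq : v ≤ ∫ t, h t ∂Q) (hq1 : ∫ t, h t ∂Q < 1) :
    (Measure.pi fun _ : Fin m => Q) {θ | blockMean h θ ≤ v} ≤
      ENNReal.ofReal (Real.exp (-(m * binaryKLReal (∫ t, h t ∂Q) v))) := by
  have hint := integrable_of_mem_Icc Q hh h01
  set q : ℝ := ∫ t, h t ∂Q with hq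
  have hq0 : 0 < q := hv0.trans_le hvq
  have hv1 : v < 1 := hvq.trans_lt hq1
  have hm' : (0 : ℝ) < m := by exact_mod_cast hm
  set l : ℝ := Real.log (v * (1 - q) / ((1 - v) * q)) with hl
  have hl0 : l ≤ 0 := by
    have hq1' := sub_pos.2 hq1
    have hv1' := sub_pos.2 hv1
    refine Real.log_nonpos (by positivity) ?_
    rw [div_le_one (by positivity)]
    linarith
  set g : Θ → ENNReal := fun t => ENNReal.ofReal (Real.exp (l * (h t - v))) with hg
  have hgm : Measurable g := by fun_prop
  have hsub : {θ : Fin m → Θ | blockMean h θ ≤ v} ⊆ {θ | 1 ≤ ∏ i, g (θ i)} := by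
    intro θ hθ
    have hθ' : 1 / (m : ℝ) * ∑ i, h (θ i) ≤ v := hθ
    rw [one_div, inv_mul_le_iff₀ hm'] at hθ'
    show 1 ≤ ∏ i, g (θ i)
    rw [hg, ← ENNReal.ofReal_prod_of_nonneg fun i _ => (Real.exp_pos _).le, ← Real.exp_sum,
      ← Finset.mul_sum, Finset.sum_sub_distrib]
    simp only [Finset.sum_const, Finset.card_univ, Fintype.card_fin, nsmul_eq_mul]
    rw [ENNReal.one_le_ofReal, Real.one_le_exp_iff]
    exact mul_nonneg_of_nonpos_of_nonpos hl0 (by linarith)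
  have hg1 : ∫⁻ t, g t ∂Q ≤ ENNReal.ofReal (Real.exp (-binaryKLReal q v)) := by
    have hi : Integrable (fun t => (1 - h t + h t * Real.exp l) * Real.exp (-(l * v))) Q :=
      (((integrable_const 1).sub hint).add (hint.mul_const _)).mul_const _
    calc ∫⁻ t, g t ∂Q
        ≤ ∫⁻ t, ENNReal.ofReal ((1 - h t + h t * Real.exp l) * Real.exp (-(l * v))) ∂Q := by
          refine lintegral_mono fun t => ENNReal.ofReal_le_ofReal ?_
          have e : l * (h t - v) = l * h t + -(l * v) := by ring
          rw [e, Real.exp_add]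
          exact mul_le_mul_of_nonneg_right (exp_mul_le_chord (h01 t).1 (h01 t).2 l)
            (Real.exp_pos _).le
      _ = ENNReal.ofReal (∫ t, (1 - h t + h t * Real.exp l) * Real.exp (-(l * v)) ∂Q) := by
          rw [ofReal_integral_eq_lintegral_ofReal hi]
          refine Filter.Eventually.of_forall fun t => ?_
          have := sub_nonneg.2 (h01 t).2
          have := (h01 t).1
          show 0 ≤ (1 - h t + h t * Real.exp l) * Real.exp (-(l * v))
          positivity
      _ = ENNReal.ofReal (Real.exp (-binaryKLReal q v)) := by
          have h1 : Integrable (fun t => 1 - h t) Q := (integrable_const 1).sub hint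
          rw [integral_mul_const, integral_add h1 (hint.mul_const _),
            integral_sub (integrable_const 1) hint, integral_mul_const, ← hq,
            ← chord_mul_exp_eq hq0 hq1 hv0 hv1]
          simp [hl]
  calc (Measure.pi fun _ : Fin m => Q) {θ | blockMean h θ ≤ v}
      ≤ (Measure.pi fun _ : Fin m => Q) {θ | 1 ≤ ∏ i, g (θ i)} := measure_mono hsub
    _ ≤ ∫⁻ θ, ∏ i, g (θ i) ∂(Measure.pi fun _ : Fin m => Q) := by
      have hmeas : Measurable fun θ : Fin m → Θ => ∏ i, g (θ i) :=
        Finset.measurable_fun_prod _ fun i _ => hgm.comp (measurable_pi_apply i)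
      simpa using mul_meas_ge_le_lintegral (μ := Measure.pi fun _ : Fin m => Q) hmeas 1
    _ = ∏ _i : Fin m, ∫⁻ t, g t ∂Q := lintegral_pi_prod Q fun _ => hgm
    _ ≤ ∏ _i : Fin m, ENNReal.ofReal (Real.exp (-binaryKLReal q v)) :=
      Finset.prod_le_prod' fun _ _ => hg1
    _ = _ := by
      rw [Finset.prod_const, Finset.card_univ, Fintype.card_fin, ← ENNReal.ofReal_pow
        (Real.exp_pos _).le, ← Real.exp_nat_mul]
      congr 2
      ring

/-- The blocks whose mean falls below `q` by more than `ε` in binary relative entropy. -/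
def lowBlocks {Θ : Type*} {m : ℕ} (h : Θ → ℝ) (q ε : ℝ) : Set (Fin m → Θ) :=
  {θ | blockMean h θ < q ∧ (ε : EReal) < binaryKL (blockMean h θ) q}

/-- The blocks whose mean exceeds `q` by more than `ε` in binary relative entropy. -/
def highBlocks {Θ : Type*} {m : ℕ} (h : Θ → ℝ) (q ε : ℝ) : Set (Fin m → Θ) :=
  {θ | q < blockMean h θ ∧ (ε : EReal) < binaryKL (blockMean h θ) q}

/-- In the nondegenerate case the set lies in a half-line event for the block mean, whose threshold
`v` has relative entropy exactly `ε`. If `q = 1` the block mean is almost surely one; if `q = 0`, or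
if even a zero mean stays within `ε`, the set is empty. -/
lemma measure_lowBlocks_le {Θ : Type*} [MeasurableSpace Θ] (Q : Measure Θ)
    [IsProbabilityMeasure Q] {h : Θ → ℝ} (hh : Measurable h)
    (h01 : ∀ θ, h θ ∈ Set.Icc (0 : ℝ) 1) {m : ℕ} (hm : 0 < m) {ε : ℝ} (hε : 0 ≤ ε) :
    (Measure.pi fun _ : Fin m => Q) (lowBlocks h (∫ t, h t ∂Q) ε) ≤
      ENNReal.ofReal (Real.exp (-(m * ε))) := by
  have hmem := integral_mem_Icc Q hh h01
  have hint := integrable_of_mem_Icc Q hh h01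
  rcases hmem.2.eq_or_lt with hq1 | hq1
  · have hae : ∀ᵐ t ∂Q, 1 - h t = 0 := by
      refine (integral_eq_zero_iff_of_nonneg (fun t => sub_nonneg.2 (h01 t).2)
        ((integrable_const 1).sub hint)).1 ?_
      rw [integral_sub (integrable_const 1) hint, hq1]
      simp
    have hae' : ∀ᵐ θ ∂(Measure.pi fun _ : Fin m => Q), ∀ i, 1 - h (θ i) = 0 := by
      rw [ae_all_iff]
      intro i
      exact (measurePreserving_eval (fun _ : Fin m => Q) i).quasiMeasurePreserving.ae hae
    have hz : (Measure.pi fun _ : Fin m => Q) (lowBlocks h (∫ t, h t ∂Q) ε) = 0 := by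
      refine measure_mono_null ?_ hae'
      intro θ hθ hθ'
      have h1 : ∀ i, h (θ i) = 1 := fun i => by linarith [hθ' i]
      have hlt : blockMean h θ < ∫ t, h t ∂Q := hθ.1
      have hm' : (m : ℝ) ≠ 0 := by exact_mod_cast hm.ne'
      rw [blockMean, hq1] at hlt
      simp [h1, hm'] at hlt
    rw [hz]
    exact zero_le
  set q : ℝ := ∫ t, h t ∂Q with hq
  rcases hmem.1.eq_or_lt with hq0 | hq0
  · have hz : (lowBlocks h q ε : Set (Fin m → Θ)) = ∅ := by
      ext θ
      simp only [Set.mem_empty_iff_false, iff_false]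
      intro hθ
      have := hθ.1
      rw [← hq0] at this
      exact absurd this (not_lt.2 (blockMean_mem_Icc hm h01 θ).1)
    rw [hz, measure_empty]
    exact zero_le
  rcases le_or_gt (binaryKLReal q 0) ε with h0 | h0
  · have hz : (lowBlocks h q ε : Set (Fin m → Θ)) = ∅ := by
      ext θ
      simp only [Set.mem_empty_iff_false, iff_false]
      intro hθ
      have hb := (blockMean_mem_Icc hm h01 θ).1
      have h2 := hθ.2
      rw [binaryKL_eq_coe hq0 hq1, EReal.coe_lt_coe_iff] at h2
      have := binaryKLReal_antitoneOn hq1 ⟨le_rfl, hq0.le⟩ ⟨hb, hθ.1.le⟩ hb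
      linarith
    rw [hz, measure_empty]
    exact zero_le
  obtain ⟨v, hv, hve⟩ : ε ∈ binaryKLReal q '' Set.Icc 0 q :=
    intermediate_value_Icc' hq0.le (continuous_binaryKLReal q).continuousOn
      ⟨by rw [binaryKLReal_self]; exact hε, h0.le⟩
  -- The strict inequality `h0` excludes `v = 0`, where the Chernoff exponent would be infinite.
  have hv0 : 0 < v := by
    rcases hv.1.eq_or_lt with rfl | h'
    · exact absurd hve h0.ne'
    · exact h'
  rw [← hve]
  refine le_trans (measure_mono ?_) (measure_blockMean_le Q hh h01 hm hv0 hv.2 hq1)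
  intro θ hθ
  by_contra hlt
  have hlt' : v < blockMean h θ := not_le.1 hlt
  have h2 := hθ.2
  rw [binaryKL_eq_coe hq0 hq1, EReal.coe_lt_coe_iff] at h2
  have := binaryKLReal_antitoneOn hq1 hv ⟨hv0.le.trans hlt'.le, hθ.1.le⟩ hlt'.le
  linarith

lemma measure_highBlocks_le {Θ : Type*} [MeasurableSpace Θ] (Q : Measure Θ)
    [IsProbabilityMeasure Q] {h : Θ → ℝ} (hh : Measurable h)
    (h01 : ∀ θ, h θ ∈ Set.Icc (0 : ℝ) 1) {m : ℕ} (hm : 0 < m) {ε : ℝ} (hε : 0 ≤ ε) :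
    (Measure.pi fun _ : Fin m => Q) (highBlocks h (∫ t, h t ∂Q) ε) ≤
      ENNReal.ofReal (Real.exp (-(m * ε))) := by
  have h01' : ∀ θ, 1 - h θ ∈ Set.Icc (0 : ℝ) 1 :=
    fun θ => ⟨sub_nonneg.2 (h01 θ).2, by linarith [(h01 θ).1]⟩
  refine le_trans (measure_mono ?_)
    (measure_lowBlocks_le Q ((by fun_prop : Measurable fun t => 1 - h t)) h01' hm hε)
  intro θ hθ
  have e : ∫ t, (1 - h t) ∂Q = 1 - ∫ t, h t ∂Q := by
    rw [integral_sub (integrable_const 1) (integrable_of_mem_Icc Q hh h01)]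
    simp
  show blockMean (fun t => 1 - h t) θ < _ ∧ _ < binaryKL (blockMean (fun t => 1 - h t) θ) _
  rw [e, blockMean_one_sub hm, binaryKL_one_sub]
  exact ⟨by linarith [hθ.1], hθ.2⟩

/-! ### The outputs of the procedure -/

/-- Here `V` is the average of the true means in a good block and `v` the reported value. If `v ≥
q`, then `v` itself is in the ball; otherwise `V ≤ v < q`, and moving the first argument up towards
`q` decreases the divergence. -/
lemma le_sSup_klBall {δ : ℝ} {K m : ℕ} {V v q : ℝ} (hV : 0 ≤ V) (hVv : V ≤ v) (hv : v ≤ 1)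
    (hq : q ∈ Set.Icc (0 : ℝ) 1) (hε : 0 ≤ Real.log ((K : ℝ) / (2 * δ)) / (m : ℝ))
    (h : ¬(V < q ∧ ((Real.log ((K : ℝ) / (2 * δ)) / (m : ℝ) : ℝ) : EReal) < binaryKL V q)) :
    q ≤ sSup (klBall δ K m v) := by
  have hbdd : BddAbove (klBall δ K m v) := ⟨1, fun u hu => hu.1.2⟩
  rcases le_or_gt q v with hqv | hqv
  · refine hqv.trans (le_csSup hbdd ⟨⟨hV.trans hVv, hv⟩, ?_⟩)
    rw [binaryKL_self]
    exact_mod_cast hε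
  · refine le_csSup hbdd ⟨hq, ?_⟩
    refine (binaryKL_anti hV hVv hqv.le hq.2).trans ?_
    by_contra hlt
    exact h ⟨hVv.trans_lt hqv, not_le.1 hlt⟩

lemma sInf_klBall_le {δ : ℝ} {K m : ℕ} {V v q : ℝ} (hV : V ≤ 1) (hVv : v ≤ V) (hv : 0 ≤ v)
    (hq : q ∈ Set.Icc (0 : ℝ) 1) (hε : 0 ≤ Real.log ((K : ℝ) / (2 * δ)) / (m : ℝ))
    (h : ¬(q < V ∧ ((Real.log ((K : ℝ) / (2 * δ)) / (m : ℝ) : ℝ) : EReal) < binaryKL V q)) :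
    sInf (klBall δ K m v) ≤ q := by
  have hbdd : BddBelow (klBall δ K m v) := ⟨0, fun u hu => hu.1.1⟩
  rcases le_or_gt v q with hqv | hqv
  · refine (csInf_le hbdd ⟨⟨hv, hVv.trans hV⟩, ?_⟩).trans hqv
    rw [binaryKL_self]
    exact_mod_cast hε
  · refine csInf_le hbdd ⟨hq, ?_⟩
    have hle : binaryKL v q ≤ binaryKL V q := by
      rw [← binaryKL_one_sub v, ← binaryKL_one_sub V]
      exact binaryKL_anti (by linarith) (by linarith) (by linarith) (by linarith [hq.1])
    refine hle.trans ?_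
    by_contra hlt
    exact h ⟨hqv.trans_le hVv, not_le.1 hlt⟩

lemma blockValues_subset_Icc {Θ 𝒳 : Type*} [MeasurableSpace Θ] {f : Θ → 𝒳 → ℝ} {Q P₀ : Measure Θ}
    {δ : ℝ} {n m : ℕ} (hm : 0 < m) {x : Fin n → 𝒳} {θ : Fin m → Θ} :
    blockValues f Q P₀ δ x θ ⊆ Set.Icc 0 1 := by
  rintro _ ⟨ν, hν, rfl⟩
  -- The candidate vector is viewed as a block of points of `[0,1]`, with the inclusion as loss.
  exact blockMean_mem_Icc (h := ((↑) : Set.Icc (0 : ℝ) 1 → ℝ)) hm (fun t => t.2)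
    fun i => ⟨ν i, hν.1 i⟩

/-- If some block admits the true means as a feasible point and their average is not much below
their expectation, then the upper output is an upper bound. -/
lemma le_upperOutput {Θ 𝒳 : Type*} [MeasurableSpace Θ] {f : Θ → 𝒳 → ℝ} {Q P₀ : Measure Θ}
    {δ : ℝ} {n K m : ℕ} (hm : 0 < m) {x : Fin n → 𝒳} {θ : Fin K → Fin m → Θ} {h : Θ → ℝ} {q : ℝ}
    (hq : q ∈ Set.Icc (0 : ℝ) 1) (hε : 0 ≤ Real.log ((K : ℝ) / (2 * δ)) / (m : ℝ)) {k : Fin K}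
    (hk : (fun i => h (θ k i)) ∈ feasible f Q P₀ δ x (θ k))
    (hlow : θ k ∉ lowBlocks h q (Real.log ((K : ℝ) / (2 * δ)) / (m : ℝ))) :
    q ≤ upperOutput f Q P₀ δ x θ := by
  have hmem : blockMean h (θ k) ∈ blockValues f Q P₀ δ x (θ k) := ⟨_, hk, rfl⟩
  have hb : ∀ j, BddAbove (blockValues f Q P₀ δ x (θ j)) :=
    fun j => ⟨1, fun u hu => (blockValues_subset_Icc hm hu).2⟩
  -- An infeasible block would count as `sSup ∅ = 0`, which respects this bound.
  have hle : ∀ j, sSup (blockValues f Q P₀ δ x (θ j)) ≤ 1 :=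
    fun j => Real.sSup_le (fun u hu => (blockValues_subset_Icc hm hu).2) zero_le_one
  refine le_sSup_klBall (blockValues_subset_Icc hm hmem).1 ?_ ?_ hq hε hlow
  · exact (le_csSup (hb k) hmem).trans
      (le_ciSup (f := fun j => sSup (blockValues f Q P₀ δ x (θ j)))
        ⟨1, by rintro _ ⟨j, rfl⟩; exact hle j⟩ k)
  · exact Real.iSup_le hle zero_le_one

lemma lowerOutput_le {Θ 𝒳 : Type*} [MeasurableSpace Θ] {f : Θ → 𝒳 → ℝ} {Q P₀ : Measure Θ}
    {δ : ℝ} {n K m : ℕ} (hm : 0 < m) {x : Fin n → 𝒳} {θ : Fin K → Fin m → Θ} {h : Θ → ℝ} {q : ℝ}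
    (hq : q ∈ Set.Icc (0 : ℝ) 1) (hε : 0 ≤ Real.log ((K : ℝ) / (2 * δ)) / (m : ℝ)) {k : Fin K}
    (hk : (fun i => h (θ k i)) ∈ feasible f Q P₀ δ x (θ k))
    (hhigh : θ k ∉ highBlocks h q (Real.log ((K : ℝ) / (2 * δ)) / (m : ℝ))) :
    lowerOutput f Q P₀ δ x θ ≤ q := by
  have hmem : blockMean h (θ k) ∈ blockValues f Q P₀ δ x (θ k) := ⟨_, hk, rfl⟩
  have hb : ∀ j, BddBelow (blockValues f Q P₀ δ x (θ j)) :=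
    fun j => ⟨0, fun u hu => (blockValues_subset_Icc hm hu).1⟩
  -- The default `sInf ∅ = 0` can only lower the output, so it is harmless here as well.
  have hle : ∀ j, 0 ≤ sInf (blockValues f Q P₀ δ x (θ j)) :=
    fun j => Real.sInf_nonneg fun u hu => (blockValues_subset_Icc hm hu).1
  refine sInf_klBall_le (blockValues_subset_Icc hm hmem).2 ?_ ?_ hq hε hhigh
  · exact (ciInf_le (f := fun j => sInf (blockValues f Q P₀ δ x (θ j)))
        ⟨0, by rintro _ ⟨j, rfl⟩; exact hle j⟩ k).trans (csInf_le (hb k) hmem)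
  · exact Real.iInf_nonneg hle

/-! ### The failure probability given the sample -/

/-- The blocks whose total log-wealth exceeds `e m b`. -/
def badBlocks {Θ : Type*} {m : ℕ} (Z : Θ → ENNReal) (b : ENNReal) : Set (Fin m → Θ) :=
  {θ | ENNReal.ofReal (Real.exp 1 * m) * b < ∑ i, Z (θ i)}

/-- Markov's inequality: the block total has mean at most `m (b + τ)` against the threshold `e m b`,
and `b ≥ L` bounds the excess `τ / b`. -/
lemma measure_badBlocks_le {Θ : Type*} [MeasurableSpace Θ] (Q : Measure Θ)
    [IsProbabilityMeasure Q] {Z : Θ → ENNReal} (hZ : Measurable Z) {m : ℕ} (hm : 0 < m)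
    {b : ENNReal} {L τ : ℝ} (hL : 0 < L) (hLb : ENNReal.ofReal L ≤ b) (hτ : 0 ≤ τ)
    (hb : ∫⁻ t, Z t ∂Q ≤ b + ENNReal.ofReal τ) :
    (Measure.pi fun _ : Fin m => Q).real (badBlocks Z b) ≤ Real.exp (-1) * (1 + τ / L) := by
  have hm' : (0 : ℝ) < m := by exact_mod_cast hm
  refine ENNReal.toReal_le_of_le_ofReal (by positivity) ?_
  rcases eq_or_ne b ⊤ with rfl | hbt
  · have : (badBlocks Z ⊤ : Set (Fin m → Θ)) = ∅ := by
      ext θ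
      simp only [badBlocks, Set.mem_ofPred_eq, Set.mem_empty_iff_false, iff_false]
      rw [ENNReal.mul_top (by simp; positivity)]
      exact not_top_lt
    rw [this, measure_empty]
    exact zero_le
  obtain ⟨r, rfl⟩ : ∃ r : ℝ, b = ENNReal.ofReal r := ⟨b.toReal, (ENNReal.ofReal_toReal hbt).symm⟩
  have hLr : L ≤ r := by
    rcases le_or_gt L r with h | h
    · exact h
    · exact absurd hLb (not_le.2 ((ENNReal.ofReal_lt_ofReal_iff hL).2 h))
  have hr : 0 < r := hL.trans_le hLr
  have hsum : ∫⁻ θ : Fin m → Θ, ∑ i, Z (θ i) ∂(Measure.pi fun _ : Fin m => Q) =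
      m * ∫⁻ t, Z t ∂Q := by
    rw [lintegral_finsetSum _ fun i _ => by fun_prop]
    simp_rw [fun i => (measurePreserving_eval (fun _ : Fin m => Q) i).lintegral_comp hZ]
    simp
  rw [badBlocks, ← ENNReal.ofReal_mul (by positivity)]
  have hpos : 0 < Real.exp 1 * m * r := by positivity
  calc (Measure.pi fun _ : Fin m => Q) {θ | ENNReal.ofReal (Real.exp 1 * m * r) < ∑ i, Z (θ i)}
      ≤ (Measure.pi fun _ : Fin m => Q) {θ | ENNReal.ofReal (Real.exp 1 * m * r) ≤ ∑ i, Z (θ i)} :=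
        measure_mono (Set.ofPred_subset_ofPred.2 fun θ hθ => hθ.le)
    _ ≤ (∫⁻ θ : Fin m → Θ, ∑ i, Z (θ i) ∂(Measure.pi fun _ : Fin m => Q)) /
          ENNReal.ofReal (Real.exp 1 * m * r) :=
        meas_ge_le_lintegral_div (Finset.measurable_fun_sum _
          fun i _ => hZ.comp (measurable_pi_apply i)).aemeasurable (by simpa using hpos)
          (by finiteness)
    _ ≤ ENNReal.ofReal (m * (r + τ)) / ENNReal.ofReal (Real.exp 1 * m * r) := by
        rw [hsum, ENNReal.ofReal_mul hm'.le, ENNReal.ofReal_natCast, ENNReal.ofReal_add hr.le hτ]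
        gcongr
    _ = ENNReal.ofReal (m * (r + τ) / (Real.exp 1 * m * r)) :=
        (ENNReal.ofReal_div_of_pos hpos).symm
    _ ≤ _ := by
        refine ENNReal.ofReal_le_ofReal ?_
        have e : m * (r + τ) / (Real.exp 1 * m * r) = Real.exp (-1) * (1 + τ / r) := by
          rw [Real.exp_neg]
          field_simp
        rw [e]
        gcongr

/-- Allows the actual probability of a bad block to be replaced by its upper bound although it also
enters with a negative sign. -/
lemma add_pow_sub_pow_mono {a p s : ℝ} (ha : 0 ≤ a) (hap : a ≤ p) (hs : 0 ≤ s) (K : ℕ) :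
    (a + s) ^ K - a ^ K ≤ (p + s) ^ K - p ^ K := by
  induction K with
  | zero => simp
  | succ K ih =>
    have e : ∀ c : ℝ, (c + s) ^ (K + 1) - c ^ (K + 1) =
      (c + s) * ((c + s) ^ K - c ^ K) + s * c ^ K := fun c => by ring
    rw [e, e]
    have h0 : 0 ≤ (a + s) ^ K - a ^ K :=
      sub_nonneg.2 (pow_le_pow_left₀ ha (by linarith) K)
    have hp : a ^ K ≤ p ^ K := pow_le_pow_left₀ ha hap K
    exact add_le_add (mul_le_mul (by linarith) ih h0 (by linarith))
      (mul_le_mul_of_nonneg_left hp hs)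

/-- Inclusion–exclusion over `K` independent draws: the probability that all of them lie in
`b ∪ l`, or all of them in `b ∪ h`. -/
lemma measure_pi_union_le {α : Type*} [MeasurableSpace α] (ρ : Measure α) [IsProbabilityMeasure ρ]
    {b l h : Set α} (hb : MeasurableSet b) {p s : ℝ} (hbp : ρ.real b ≤ p)
    (hls : ρ.real l ≤ s) (hhs : ρ.real h ≤ s) (K : ℕ) :
    (Measure.pi fun _ : Fin K => ρ).real ({θ | ∀ k, θ k ∈ b ∪ l} ∪ {θ | ∀ k, θ k ∈ b ∪ h}) ≤
      2 * (p + s) ^ K - p ^ K := by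
  have hpi : ∀ A : Set α, (Measure.pi fun _ : Fin K => ρ).real {θ | ∀ k, θ k ∈ A} =
      ρ.real A ^ K := by
    intro A
    have : {θ : Fin K → α | ∀ k, θ k ∈ A} = Set.univ.pi fun _ => A := by ext; simp
    rw [this, measureReal_def, Measure.pi_pi]
    simp [measureReal_def]
  have hs0 : 0 ≤ s := measureReal_nonneg.trans hls
  have ha0 : 0 ≤ ρ.real b := measureReal_nonneg
  have hbm : MeasurableSet {θ : Fin K → α | ∀ k, θ k ∈ b} := by
    have : {θ : Fin K → α | ∀ k, θ k ∈ b} = Set.univ.pi fun _ => b := by ext; simp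
    rw [this]
    exact MeasurableSet.univ_pi fun _ => hb
  -- The event that all draws lie in `b` belongs to both families; removing it from the second gains
  -- the term `p ^ K`. Only `b` has to be measurable for the difference.
  have hsub : ({θ | ∀ k, θ k ∈ b ∪ l} ∪ {θ | ∀ k, θ k ∈ b ∪ h} : Set (Fin K → α)) ⊆
      {θ | ∀ k, θ k ∈ b ∪ l} ∪ ({θ | ∀ k, θ k ∈ b ∪ h} \ {θ | ∀ k, θ k ∈ b}) := by
    rintro θ (hθ | hθ)
    · exact Or.inl hθ
    · by_cases hall : ∀ k, θ k ∈ b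
      · exact Or.inl fun k => Or.inl (hall k)
      · exact Or.inr ⟨hθ, hall⟩
  have hbh : {θ : Fin K → α | ∀ k, θ k ∈ b} ⊆ {θ | ∀ k, θ k ∈ b ∪ h} :=
    Set.ofPred_subset_ofPred.2 fun θ hθ k => Or.inl (hθ k)
  have hu : ∀ c : Set α, ρ.real c ≤ s → ρ.real (b ∪ c) ≤ ρ.real b + s :=
    fun c hc => (measureReal_union_le b c).trans (by linarith)
  have h1 : (ρ.real (b ∪ l)) ^ K ≤ (p + s) ^ K :=
    pow_le_pow_left₀ measureReal_nonneg ((hu l hls).trans (by linarith)) K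
  have h2 : (ρ.real (b ∪ h)) ^ K ≤ (ρ.real b + s) ^ K :=
    pow_le_pow_left₀ measureReal_nonneg (hu h hhs) K
  have h3 := add_pow_sub_pow_mono ha0 hbp hs0 K
  calc _ ≤ _ := measureReal_mono hsub
    _ ≤ _ := measureReal_union_le _ _
    _ = ρ.real (b ∪ l) ^ K + (ρ.real (b ∪ h) ^ K - ρ.real b ^ K) := by
      rw [measureReal_sdiff hbh hbm, hpi, hpi, hpi]
    _ ≤ _ := by linarith

/-! ### Numerical bounds -/

lemma exp_neg_one_lt : Real.exp (-1) < 0.36788 := by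
  rw [Real.exp_neg, inv_lt_comm₀ (Real.exp_pos 1) (by norm_num)]
  exact lt_trans (by norm_num) Real.exp_one_gt_d9

lemma posPart_log_le {z : ℝ} (hz : 0 ≤ z) : max 0 (Real.log z) ≤ Real.exp (-1) * z := by
  have h0 : 0 ≤ Real.exp (-1) * z := by positivity
  refine max_le h0 ?_
  rcases hz.eq_or_lt with rfl | hz
  · simp
  have := Real.log_le_sub_one_of_pos (show 0 < Real.exp (-1) * z by positivity)
  rw [Real.log_mul (Real.exp_pos _).ne' hz.ne', Real.log_exp] at this
  linarith

/-- Apply the linear bound to `√z` and use `log z = 2 log √z`. -/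
lemma posPart_log_sq_le {z : ℝ} (hz : 0 ≤ z) :
    max 0 (Real.log z) ^ 2 ≤ 4 * Real.exp (-1) ^ 2 * z := by
  have h := posPart_log_le (Real.sqrt_nonneg z)
  have e : max 0 (Real.log z) = 2 * max 0 (Real.log (Real.sqrt z)) := by
    rw [Real.log_sqrt hz, mul_max_of_nonneg _ _ zero_le_two]
    congr 1 <;> ring
  rw [e]
  have h2 := pow_le_pow_left₀ (le_max_left _ _) h 2
  rw [mul_pow _ (Real.sqrt z), Real.sq_sqrt hz] at h2
  nlinarith

/-- With `x = e⁻¹` and `y = 2eδ` one has `(x + 2δ/K)^K ≤ x^K exp y ≤ x^K (1 + y + y²)`. Since `x^K ≤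
δ` and `x^K ≤ x³`, the left side is at most `δ (1 + 4x² + 8x³)`, and the bracket is below 2. -/
lemma two_mul_pow_sub_pow_le {δ : ℝ} (hδ0 : 0 < δ) {K : ℕ} (hK3 : 3 ≤ K)
    (hKl : Real.exp (-1) ^ K ≤ δ) (hδ2 : δ ≤ Real.exp (-1) ^ 2) :
    2 * (Real.exp (-1) + 2 * δ / K) ^ K - Real.exp (-1) ^ K ≤ 2 * δ := by
  have hx := exp_neg_one_lt
  have hx0 := Real.exp_pos (-1)
  have hex : Real.exp 1 * Real.exp (-1) = 1 := by rw [← Real.exp_add]; simp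
  set x := Real.exp (-1) with hxd
  have hK0 : (0 : ℝ) < K := by exact_mod_cast (by omega : 0 < K)
  set e := Real.exp 1
  have he0 : 0 < e := Real.exp_pos 1
  set y := 2 * e * δ with hy
  have hy0 : 0 ≤ y := by positivity
  have hxy : x * y = 2 * δ := by rw [hy]; linear_combination 2 * δ * hex
  have hy2 : y ≤ 2 * x := by
    have : x * y ≤ x * (2 * x) := by rw [hxy]; nlinarith
    exact le_of_mul_le_mul_left this hx0
  have hexp : Real.exp y ≤ 1 + y + y ^ 2 := by
    have := Real.abs_exp_sub_one_sub_id_le (x := y) (by rw [abs_of_nonneg hy0]; linarith)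
    linarith [(abs_le.1 this).2]
  have hpow : (x + 2 * δ / K) ^ K ≤ x ^ K * Real.exp y := by
    have e1 : x + 2 * δ / K = x * (1 + y / K) := by rw [← hxy]; field_simp
    rw [e1, mul_pow]
    refine mul_le_mul_of_nonneg_left ?_ (by positivity)
    have h1 : 1 + y / K ≤ Real.exp (y / K) := by linarith [Real.add_one_le_exp (y / K)]
    have h2 := pow_le_pow_left₀ (by positivity) h1 K
    rwa [← Real.exp_nat_mul, mul_div_cancel₀ _ hK0.ne'] at h2
  have hE3 : x ^ K ≤ x ^ 3 := pow_le_pow_of_le_one hx0.le (by linarith) hK3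
  have hE0 : 0 < x ^ K := by positivity
  set E := x ^ K
  have h1 : E * y ≤ 2 * x ^ 2 * δ := by
    calc E * y ≤ x ^ 3 * y := by gcongr
      _ = x ^ 2 * (x * y) := by ring
      _ = _ := by rw [hxy]; ring
  have h2 : E * y ^ 2 ≤ 4 * x ^ 3 * δ := by
    calc E * y ^ 2 = (E * y) * y := by ring
      _ ≤ (2 * x ^ 2 * δ) * (2 * x) := by gcongr
      _ = _ := by ring
  have h3 : E * Real.exp y ≤ E * (1 + y + y ^ 2) := by gcongr
  have hx2 : x ^ 2 ≤ 0.36788 ^ 2 := pow_le_pow_left₀ hx0.le hx.le 2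
  have hx3 : x ^ 3 ≤ 0.36788 ^ 3 := pow_le_pow_left₀ hx0.le hx.le 3
  have h4 : x ^ 2 * δ ≤ 0.36788 ^ 2 * δ := by gcongr
  have h5 : x ^ 3 * δ ≤ 0.36788 ^ 3 * δ := by gcongr
  norm_num at h4 h5
  linarith

/-- The difference of the two sides is a convex quadratic in `δ`, so it suffices to check the
endpoints `e⁻²` and `1/3`: these are `hA` and `hB`, and `hq` is the convexity defect. -/
lemma quadratic_coeff_le {δ : ℝ} (hδ2 : Real.exp (-1) ^ 2 ≤ δ) (hδ3 : δ ≤ 1 / 3) :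
    (Real.exp (-1) ^ 2 + 4 * δ * Real.exp (-1) + 2 * δ ^ 2) +
      δ * (2 * Real.exp (-1) ^ 3 + 4 * Real.exp (-1) ^ 4 + 4 * δ * Real.exp (-1) ^ 2) ≤ 3 * δ := by
  have hx := exp_neg_one_lt
  have hx0 := Real.exp_pos (-1)
  set x := Real.exp (-1)
  have hx2 : x ^ 2 ≤ 0.36788 ^ 2 := pow_le_pow_left₀ hx0.le hx.le 2
  have hx3 : x ^ 3 ≤ 0.36788 ^ 3 := pow_le_pow_left₀ hx0.le hx.le 3
  have hx4 : x ^ 4 ≤ 0.36788 ^ 4 := pow_le_pow_left₀ hx0.le hx.le 4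
  have hx6 : 0 ≤ x ^ 2 := by positivity
  have hA : -2 + 4 * x + 2 * x ^ 2 + 2 * x ^ 3 + 8 * x ^ 4 ≤ 0 := by
    norm_num at hx2 hx3 hx4
    linarith
  have hB : x ^ 2 + 4 / 3 * x + 2 / 9 + 1 / 3 * (2 * x ^ 3 + 4 * x ^ 4 + 4 / 3 * x ^ 2) ≤ 1 := by
    norm_num at hx2 hx3 hx4
    linarith
  have hc : x ^ 2 < 1 / 3 := by norm_num at hx2; linarith
  have hq : 0 ≤ (δ - x ^ 2) * (1 / 3 - δ) * ((2 + 4 * x ^ 2) * (1 / 3 - x ^ 2)) :=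
    mul_nonneg (mul_nonneg (by linarith) (by linarith))
      (mul_nonneg (by positivity) (by linarith))
  have hA' := mul_nonneg (mul_nonneg hx6 (neg_nonneg.2 hA)) (by linarith : 0 ≤ 1 / 3 - δ)
  have hB' := mul_nonneg (sub_nonneg.2 hB) (by linarith : 0 ≤ δ - x ^ 2)
  have h13 : 0 < 1 / 3 - x ^ 2 := by linarith
  refine le_of_mul_le_mul_left ?_ h13
  linarith

/-- An affine majorant, in the mixture wealth `w`, of the failure probability given the sample. -/
lemma exists_affine_majorant {δ : ℝ} (hδ0 : 0 < δ) (hδ3 : δ < 1 / 3) {K : ℕ}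
    (hK : K = ⌈Real.log (1 / δ)⌉₊) :
    ∃ c₀ c₁ : ℝ, 0 ≤ c₀ ∧ 0 ≤ c₁ ∧ c₀ + c₁ ≤ 3 * δ ∧ ∀ w p : ℝ, 0 ≤ w →
      p = Real.exp (-1) * (1 + max 0 (Real.log (δ * w)) / Real.log (1 / δ)) →
      min 1 (2 * (p + 2 * δ / K) ^ K - p ^ K) ≤ c₀ + c₁ * w := by
  have hx := exp_neg_one_lt
  have hx0 := Real.exp_pos (-1)
  have hL1 : 1 < Real.log (1 / δ) := by
    rw [Real.lt_log_iff_exp_lt (by positivity), lt_div_iff₀ hδ0]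
    have := Real.exp_one_lt_d9
    nlinarith [Real.exp_pos 1]
  have hδe : δ = Real.exp (-Real.log (1 / δ)) := by
    rw [one_div, Real.log_inv, neg_neg, Real.exp_log hδ0]
  have hpw : ∀ j : ℕ, Real.exp (-1) ^ j = Real.exp (-(j : ℝ)) := by
    intro j; rw [← Real.exp_nat_mul]; congr 1; ring
  have hKge : 2 ≤ K := by rw [hK]; exact Nat.lt_ceil.2 (by exact_mod_cast hL1)
  have hKl : Real.exp (-1) ^ K ≤ δ := by
    conv_rhs => rw [hδe]
    rw [hpw, Real.exp_le_exp, neg_le_neg_iff, hK]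
    exact Nat.le_ceil _
  rcases hKge.eq_or_lt with rfl | hK3
  -- For `K = 2` the bound at zero excess can exceed `2δ`, so the split used for `K ≥ 3` fails.
  -- Instead `p ≤ e⁻¹ (1 + τ)` is expanded: `c₀` collects the terms without `τ`, and `c₁` those in
  -- `τ` and `τ²`, made linear in `w` by the two logarithm bounds.
  · refine ⟨Real.exp (-1) ^ 2 + 4 * δ * Real.exp (-1) + 2 * δ ^ 2,
      δ * (2 * Real.exp (-1) ^ 3 + 4 * Real.exp (-1) ^ 4 + 4 * δ * Real.exp (-1) ^ 2),
      by positivity, by positivity, quadratic_coeff_le hKl hδ3.le, ?_⟩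
    intro w p hw hp
    refine (min_le_right _ _).trans ?_
    have hz : 0 ≤ δ * w := by positivity
    have h1 := posPart_log_le hz
    have h2 := posPart_log_sq_le hz
    set τ := max 0 (Real.log (δ * w))
    have hτ0 : 0 ≤ τ := le_max_left _ _
    have hp0 : 0 ≤ p := by rw [hp]; positivity
    have hp1 : p ≤ Real.exp (-1) * (1 + τ) := by
      rw [hp]
      gcongr
      exact div_le_self hτ0 hL1.le
    set x := Real.exp (-1)
    have hp2 := pow_le_pow_left₀ hp0 hp1 2
    have e : 2 * (p + 2 * δ / (2 : ℕ)) ^ 2 - p ^ 2 = p ^ 2 + 4 * δ * p + 2 * δ ^ 2 := by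
      push_cast; ring
    rw [e]
    have h3 : 4 * δ * p ≤ 4 * δ * (x * (1 + τ)) := by gcongr
    have h4 : x ^ 2 * τ ≤ x ^ 2 * (x * (δ * w)) := by gcongr
    have h5 : x ^ 2 * τ ^ 2 ≤ x ^ 2 * (4 * x ^ 2 * (δ * w)) := by gcongr
    have h6 : δ * x * τ ≤ δ * x * (x * (δ * w)) := by gcongr
    linarith
  · have hδ2 : δ ≤ Real.exp (-1) ^ 2 := by
      conv_lhs => rw [hδe]
      rw [hpw, Real.exp_le_exp, neg_le_neg_iff]
      have : 2 < ⌈Real.log (1 / δ)⌉₊ := hK ▸ hK3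
      exact (Nat.lt_ceil.1 this).le
    -- If `δ w ≤ 1` the excess vanishes and the numerical bound gives `2δ`; otherwise the trivial
    -- bound one is below `δ w`.
    refine ⟨2 * δ, δ, by positivity, by positivity, by linarith, ?_⟩
    intro w p hw hp
    rcases le_or_gt (δ * w) 1 with h | h
    · have hlog : Real.log (δ * w) ≤ 0 := Real.log_nonpos (by positivity) h
      rw [max_eq_left hlog, zero_div, add_zero, mul_one] at hp
      have h0 : 0 ≤ δ * w := by positivity
      rw [hp]
      exact (min_le_right _ _).trans ((two_mul_pow_sub_pow_le hδ0 hK3 hKl hδ2).trans (by linarith))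
    · exact (min_le_left _ _).trans (by linarith)

/-! ### The confidence interval -/

lemma posLog_ofReal_eq_max {z : ℝ} (hz : 0 ≤ z) :
    posLog (ENNReal.ofReal z) = ENNReal.ofReal (max 0 (Real.log z)) := by
  rcases hz.eq_or_lt with rfl | hz
  · simp [posLog_zero]
  · rw [posLog_ofReal hz, ENNReal.ofReal_max]
    simp

section

variable {𝒳 Θ : Type*} [MeasurableSpace 𝒳] [MeasurableSpace Θ]

/-- The expected loss of a parameter. -/
def meanLoss (f : Θ → 𝒳 → ℝ) (D : Measure 𝒳) (t : Θ) : ℝ := ∫ x, f t x ∂D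

/-- The Krichevsky–Trofimov wealth against the true mean of the parameter. -/
def trueWealth (f : Θ → 𝒳 → ℝ) (D : Measure 𝒳) {n : ℕ} (x : Fin n → 𝒳) (t : Θ) : ENNReal :=
  ktWealth (meanLoss f D t) fun i => f t (x i)

/-- An upper bound of the optimal log-wealth against the true mean. -/
def logWealthBound (f : Θ → 𝒳 → ℝ) (D : Measure 𝒳) {n : ℕ} (x : Fin n → 𝒳) (t : Θ) : ENNReal :=
  posLog (ENNReal.ofReal (regret n) * trueWealth f D x t)

/-- The wealth averaged over the prior. -/
def priorWealth (f : Θ → 𝒳 → ℝ) (D : Measure 𝒳) (P₀ : Measure Θ) {n : ℕ} (x : Fin n → 𝒳) :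
    ENNReal := ∫⁻ t, trueWealth f D x t ∂P₀

/-- A lower bound, measurable in the sample, of the complexity term plus `ln (1/δ)`. -/
def budget (f : Θ → 𝒳 → ℝ) (D : Measure 𝒳) (Q P₀ : Measure Θ) (δ : ℝ) {n : ℕ} (x : Fin n → 𝒳) :
    ENNReal :=
  max (ENNReal.ofReal (Real.log (1 / δ)))
    (∫⁻ t, logWealthBound f D x t ∂Q - posLog (ENNReal.ofReal δ * priorWealth f D P₀ x))

/-- The draws on which every block is bad or too low, or every block is bad or too high. -/
def failureSet (f : Θ → 𝒳 → ℝ) (D : Measure 𝒳) (Q P₀ : Measure Θ) (δ ε : ℝ) {n : ℕ} (K m : ℕ)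
    (x : Fin n → 𝒳) : Set (Fin K → Fin m → Θ) :=
  {θ | ∀ k, θ k ∈ badBlocks (logWealthBound f D x) (budget f D Q P₀ δ x) ∪
      lowBlocks (meanLoss f D) (∫ t, meanLoss f D t ∂Q) ε} ∪
    {θ | ∀ k, θ k ∈ badBlocks (logWealthBound f D x) (budget f D Q P₀ δ x) ∪
      highBlocks (meanLoss f D) (∫ t, meanLoss f D t ∂Q) ε}


/-! ### Joint measurability in the sample and the draws -/

lemma measurable_meanLoss {f : Θ → 𝒳 → ℝ} (hf : Measurable (Function.uncurry f)) (D : Measure 𝒳)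
    [IsProbabilityMeasure D] : Measurable (meanLoss f D) :=
  (hf.stronglyMeasurable.integral_prod_right' (ν := D)).measurable

lemma meanLoss_mem_Icc {f : Θ → 𝒳 → ℝ} (hf : Measurable (Function.uncurry f))
    (hf01 : ∀ θ x, f θ x ∈ Set.Icc (0 : ℝ) 1) (D : Measure 𝒳) [IsProbabilityMeasure D] (t : Θ) :
    meanLoss f D t ∈ Set.Icc (0 : ℝ) 1 :=
  integral_mem_Icc D (hf.comp measurable_prodMk_left) (hf01 t)

lemma measurable_trueWealth {f : Θ → 𝒳 → ℝ} (hf : Measurable (Function.uncurry f)) (D : Measure 𝒳)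
    [IsProbabilityMeasure D] {n : ℕ} :
    Measurable fun p : (Fin n → 𝒳) × Θ => trueWealth f D p.1 p.2 := by
  refine measurable_ktWealth ((measurable_meanLoss hf D).comp measurable_snd) fun i => ?_
  exact hf.comp (measurable_snd.prodMk ((measurable_pi_apply i).comp measurable_fst))

lemma measurable_logWealthBound {f : Θ → 𝒳 → ℝ} (hf : Measurable (Function.uncurry f))
    (D : Measure 𝒳) [IsProbabilityMeasure D] {n : ℕ} :
    Measurable fun p : (Fin n → 𝒳) × Θ => logWealthBound f D p.1 p.2 :=
  measurable_posLog.comp ((measurable_trueWealth hf D).const_mul _)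

lemma measurable_priorWealth {f : Θ → 𝒳 → ℝ} (hf : Measurable (Function.uncurry f))
    (D : Measure 𝒳) [IsProbabilityMeasure D] (P₀ : Measure Θ) [IsProbabilityMeasure P₀] {n : ℕ} :
    Measurable fun x : Fin n → 𝒳 => priorWealth f D P₀ x :=
  (measurable_trueWealth hf D).lintegral_prod_right'

/-- The reason for using the budget: it is built from kernel integrals, whereas measurability of the
divergence of the posterior in the sample is not assumed. -/
lemma measurable_budget {f : Θ → 𝒳 → ℝ} (hf : Measurable (Function.uncurry f))
    (D : Measure 𝒳) [IsProbabilityMeasure D] (P₀ : Measure Θ) [IsProbabilityMeasure P₀] (δ : ℝ)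
    {n : ℕ} (post : Kernel (Fin n → 𝒳) Θ) [IsMarkovKernel post] :
    Measurable fun x : Fin n → 𝒳 => budget f D (post x) P₀ δ x := by
  have h1 : Measurable fun x : Fin n → 𝒳 => ∫⁻ t, logWealthBound f D x t ∂(post x) :=
    Measurable.lintegral_kernel_prod_right' (measurable_logWealthBound hf D)
  have h2 := measurable_priorWealth (n := n) hf D P₀
  unfold budget
  fun_prop

lemma measurableSet_badBlocks {f : Θ → 𝒳 → ℝ} (hf : Measurable (Function.uncurry f))
    (D : Measure 𝒳) [IsProbabilityMeasure D] (P₀ : Measure Θ) [IsProbabilityMeasure P₀] (δ : ℝ)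
    {n m : ℕ} (post : Kernel (Fin n → 𝒳) Θ) [IsMarkovKernel post] :
    MeasurableSet {p : (Fin n → 𝒳) × (Fin m → Θ) |
      p.2 ∈ badBlocks (logWealthBound f D p.1) (budget f D (post p.1) P₀ δ p.1)} := by
  simp only [badBlocks, Set.mem_ofPred_eq]
  have hb : Measurable fun p : (Fin n → 𝒳) × (Fin m → Θ) => budget f D (post p.1) P₀ δ p.1 :=
    (measurable_budget hf D P₀ δ post).comp measurable_fst
  have hZ : ∀ i : Fin m, Measurable fun p : (Fin n → 𝒳) × (Fin m → Θ) =>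
      logWealthBound f D p.1 (p.2 i) := by
    intro i
    have hpair : Measurable fun p : (Fin n → 𝒳) × (Fin m → Θ) => (p.1, p.2 i) := by fun_prop
    exact (measurable_logWealthBound (n := n) hf D).comp hpair
  exact measurableSet_lt (hb.const_mul _) (Finset.measurable_fun_sum _ fun i _ => hZ i)

lemma measurable_integral_meanLoss {f : Θ → 𝒳 → ℝ} (hf : Measurable (Function.uncurry f))
    (D : Measure 𝒳) [IsProbabilityMeasure D] {n : ℕ} (post : Kernel (Fin n → 𝒳) Θ)
    [IsMarkovKernel post] : Measurable fun x => ∫ t, meanLoss f D t ∂(post x) :=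
  ((measurable_meanLoss hf D).stronglyMeasurable.integral_kernel (κ := post)).measurable

lemma measurable_blockMean {h : Θ → ℝ} (hh : Measurable h) {m : ℕ} :
    Measurable fun θ : Fin m → Θ => blockMean h θ := by
  unfold blockMean
  fun_prop

lemma measurableSet_failureSet {f : Θ → 𝒳 → ℝ} (hf : Measurable (Function.uncurry f))
    (D : Measure 𝒳) [IsProbabilityMeasure D] (P₀ : Measure Θ) [IsProbabilityMeasure P₀] (δ ε : ℝ)
    {n K m : ℕ} (post : Kernel (Fin n → 𝒳) Θ) [IsMarkovKernel post] :
    MeasurableSet {p : (Fin n → 𝒳) × (Fin K → Fin m → Θ) |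
      p.2 ∈ failureSet f D (post p.1) P₀ δ ε K m p.1} := by
  have hq : Measurable fun p : (Fin n → 𝒳) × (Fin m → Θ) => ∫ t, meanLoss f D t ∂(post p.1) :=
    (measurable_integral_meanLoss hf D post).comp measurable_fst
  have hV : Measurable fun p : (Fin n → 𝒳) × (Fin m → Θ) => blockMean (meanLoss f D) p.2 :=
    (measurable_blockMean (measurable_meanLoss hf D)).comp measurable_snd
  have hkl := measurableSet_lt (measurable_const (a := (ε : EReal))) (measurable_binaryKL hV hq)
  have hb := measurableSet_badBlocks (m := m) hf D P₀ δ post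
  have hsec : ∀ {A : Set ((Fin n → 𝒳) × (Fin m → Θ))}, MeasurableSet A →
      MeasurableSet {p : (Fin n → 𝒳) × (Fin K → Fin m → Θ) | ∀ k, (p.1, p.2 k) ∈ A} := by
    intro A hA
    rw [Set.ofPred_forall]
    refine MeasurableSet.iInter fun k => ?_
    exact (measurable_fst.prodMk ((measurable_pi_apply k).comp measurable_snd)) hA
  exact (hsec (hb.union ((measurableSet_lt hV hq).inter hkl))).union
    (hsec (hb.union ((measurableSet_lt hq hV).inter hkl)))

/-! ### Validity of the budget and the failure probability -/

/-- Tonelli applies because the prior does not depend on the sample. -/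
lemma lintegral_priorWealth_le_one {f : Θ → 𝒳 → ℝ} (hf : Measurable (Function.uncurry f))
    (hf01 : ∀ θ x, f θ x ∈ Set.Icc (0 : ℝ) 1) (D : Measure 𝒳) [IsProbabilityMeasure D]
    (P₀ : Measure Θ) [IsProbabilityMeasure P₀] (n : ℕ) :
    ∫⁻ x, priorWealth f D P₀ x ∂(Measure.pi fun _ : Fin n => D) ≤ 1 := by
  unfold priorWealth
  rw [lintegral_lintegral_swap (measurable_trueWealth hf D).aemeasurable]
  calc _ ≤ ∫⁻ _, 1 ∂P₀ := lintegral_mono fun t =>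
        lintegral_ktWealth_le_one D (hf.comp measurable_prodMk_left) (hf01 t)
    _ = 1 := by simp

/-- Donsker–Varadhan for `regret n` times the wealth. Writing the prior average as `(regret n / δ) ·
(δ w)` splits off `ln (1/δ)` and leaves an excess that vanishes when `w ≤ 1/δ`. -/
lemma lintegral_logWealthBound_le {f : Θ → 𝒳 → ℝ} (hf : Measurable (Function.uncurry f))
    (hf01 : ∀ θ x, f θ x ∈ Set.Icc (0 : ℝ) 1) (D : Measure 𝒳) [IsProbabilityMeasure D]
    (Q P₀ : Measure Θ) [IsProbabilityMeasure Q] [IsProbabilityMeasure P₀] {δ : ℝ} (hδ0 : 0 < δ)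
    (hδ1 : δ ≤ 1) {n : ℕ} (x : Fin n → 𝒳) :
    ∫⁻ t, logWealthBound f D x t ∂Q ≤ InformationTheory.klDiv Q P₀ +
      ENNReal.ofReal (Real.log (regret n)) + ENNReal.ofReal (Real.log (1 / δ)) +
        posLog (ENNReal.ofReal δ * priorWealth f D P₀ x) := by
  have hW : Measurable fun t => trueWealth f D x t :=
    (measurable_trueWealth (n := n) hf D).comp measurable_prodMk_left
  have hR := regret_pos n
  have hW1 : ∀ t, 1 ≤ ENNReal.ofReal (regret n) * trueWealth f D x t := fun t =>
    one_le_regret_mul_ktWealth (meanLoss_mem_Icc hf hf01 D t) fun i => hf01 t (x i)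
  refine (lintegral_posLog_le Q P₀ (hW.const_mul _) hW1).trans ?_
  rw [lintegral_const_mul _ hW, add_assoc, add_assoc]
  refine add_le_add_right ?_ _
  have e : ENNReal.ofReal (regret n) * ∫⁻ t, trueWealth f D x t ∂P₀ =
      ENNReal.ofReal (regret n * (1 / δ)) * (ENNReal.ofReal δ * priorWealth f D P₀ x) := by
    rw [← mul_assoc, ← ENNReal.ofReal_mul (by positivity)]
    congr 2
    field_simp
  rw [e]
  refine (posLog_mul_le _ _).trans ?_
  rw [posLog_ofReal (by positivity), Real.log_mul hR.ne' (by positivity),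
    ENNReal.ofReal_add (Real.log_nonneg (one_le_regret n))
      (Real.log_nonneg (by rw [le_div_iff₀ hδ0]; linarith)), add_assoc]

lemma budget_le_complexity {f : Θ → 𝒳 → ℝ} (hf : Measurable (Function.uncurry f))
    (hf01 : ∀ θ x, f θ x ∈ Set.Icc (0 : ℝ) 1) (D : Measure 𝒳) [IsProbabilityMeasure D]
    (Q P₀ : Measure Θ) [IsProbabilityMeasure Q] [IsProbabilityMeasure P₀] {δ : ℝ} (hδ0 : 0 < δ)
    (hδ1 : δ ≤ 1) {n : ℕ} (x : Fin n → 𝒳) :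
    (budget f D Q P₀ δ x : EReal) ≤
      complexity n Q P₀ + ((Real.log (1 / δ) : ℝ) : EReal) := by
  have hR := Real.log_nonneg (one_le_regret n)
  have hL : 0 ≤ Real.log (1 / δ) := Real.log_nonneg (by rw [le_div_iff₀ hδ0]; linarith)
  have e : complexity n Q P₀ + ((Real.log (1 / δ) : ℝ) : EReal) =
      ((InformationTheory.klDiv Q P₀ + ENNReal.ofReal (Real.log (regret n)) +
        ENNReal.ofReal (Real.log (1 / δ)) : ENNReal) : EReal) := by
    rw [complexity, sqrt_pi_mul_Gamma_div_Gamma, EReal.coe_ennreal_add, EReal.coe_ennreal_add,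
      EReal.coe_ennreal_ofReal, EReal.coe_ennreal_ofReal, max_eq_left hR, max_eq_left hL]
  rw [e, EReal.coe_ennreal_le_coe_ennreal_iff]
  refine max_le le_add_self ?_
  rw [tsub_le_iff_right]
  exact lintegral_logWealthBound_le hf hf01 D Q P₀ hδ0 hδ1 x

/-- Passing to the smaller budget only enlarges the set of bad blocks, so outside it the original
constraint holds at the true means. -/
lemma feasible_of_notMem_badBlocks {f : Θ → 𝒳 → ℝ} (hf : Measurable (Function.uncurry f))
    (hf01 : ∀ θ x, f θ x ∈ Set.Icc (0 : ℝ) 1) (D : Measure 𝒳) [IsProbabilityMeasure D]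
    (Q P₀ : Measure Θ) [IsProbabilityMeasure Q] [IsProbabilityMeasure P₀] {δ : ℝ} (hδ0 : 0 < δ)
    (hδ1 : δ ≤ 1) {n m : ℕ} (hm : 0 < m) {x : Fin n → 𝒳} {θ : Fin m → Θ}
    (hθ : θ ∉ badBlocks (logWealthBound f D x) (budget f D Q P₀ δ x)) :
    (fun i => meanLoss f D (θ i)) ∈ feasible f Q P₀ δ x θ := by
  have hm' : (0 : ℝ) < m := by exact_mod_cast hm
  refine ⟨fun i => meanLoss_mem_Icc hf hf01 D _, ?_⟩
  have hle : ∑ i, logWealthBound f D x (θ i) ≤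
      ENNReal.ofReal (Real.exp 1 * m) * budget f D Q P₀ δ x := not_lt.1 hθ
  have hsum : ∑ i, optLogWealth f x (θ i) (meanLoss f D (θ i)) ≤
      ((∑ i, logWealthBound f D x (θ i) : ENNReal) : EReal) := by
    have hcoe : ((∑ i, logWealthBound f D x (θ i) : ENNReal) : EReal) =
        ∑ i, (logWealthBound f D x (θ i) : EReal) :=
      map_sum (⟨⟨(↑), EReal.coe_ennreal_zero⟩, EReal.coe_ennreal_add⟩ : ENNReal →+ EReal) _ _
    rw [hcoe]
    refine Finset.sum_le_sum fun i _ => ?_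
    exact (optLogWealth_le_log hf01 x (θ i) (meanLoss_mem_Icc hf hf01 D _)).trans (log_le_posLog _)
  have hc : (0 : ℝ) ≤ 1 / (Real.exp 1 * m) := by positivity
  have hcoe : ((1 / (Real.exp 1 * (m : ℝ)) : ℝ) : EReal) =
      ((ENNReal.ofReal (1 / (Real.exp 1 * m)) : ENNReal) : EReal) := by
    rw [EReal.coe_ennreal_ofReal, max_eq_left hc]
  refine le_trans ?_ (budget_le_complexity hf hf01 D Q P₀ hδ0 hδ1 x)
  calc _ ≤ ((1 / (Real.exp 1 * (m : ℝ)) : ℝ) : EReal) *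
        ((ENNReal.ofReal (Real.exp 1 * m) * budget f D Q P₀ δ x : ENNReal) : EReal) :=
        mul_le_mul_of_nonneg_left
          (hsum.trans (EReal.coe_ennreal_le_coe_ennreal_iff.2 hle)) (by exact_mod_cast hc)
    _ = _ := by
      rw [hcoe, ← EReal.coe_ennreal_mul, ← mul_assoc, ← ENNReal.ofReal_mul hc,
        one_div_mul_cancel (by positivity), ENNReal.ofReal_one, one_mul]

/-- Outside the failure set both outputs are correct. -/
lemma outputs_of_notMem_failureSet {f : Θ → 𝒳 → ℝ} (hf : Measurable (Function.uncurry f))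
    (hf01 : ∀ θ x, f θ x ∈ Set.Icc (0 : ℝ) 1) (D : Measure 𝒳) [IsProbabilityMeasure D]
    (Q P₀ : Measure Θ) [IsProbabilityMeasure Q] [IsProbabilityMeasure P₀] {δ : ℝ} (hδ0 : 0 < δ)
    (hδ1 : δ ≤ 1) {n K m : ℕ} (hm : 0 < m)
    (hε : 0 ≤ Real.log ((K : ℝ) / (2 * δ)) / (m : ℝ)) {x : Fin n → 𝒳} {θ : Fin K → Fin m → Θ}
    (hθ : θ ∉ failureSet f D Q P₀ δ (Real.log ((K : ℝ) / (2 * δ)) / (m : ℝ)) K m x) :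
    lowerOutput f Q P₀ δ x θ ≤ ∫ t, meanLoss f D t ∂Q ∧
      ∫ t, meanLoss f D t ∂Q ≤ upperOutput f Q P₀ δ x θ := by
  have hq := integral_mem_Icc Q (measurable_meanLoss hf D) (meanLoss_mem_Icc hf hf01 D)
  rw [failureSet, Set.mem_union, not_or] at hθ
  obtain ⟨h1, h2⟩ := hθ
  obtain ⟨k, hk⟩ := not_forall.1 h1
  obtain ⟨j, hj⟩ := not_forall.1 h2
  rw [Set.mem_union, not_or] at hk hj
  exact ⟨lowerOutput_le (h := meanLoss f D) hm hq hε
      (feasible_of_notMem_badBlocks hf hf01 D Q P₀ hδ0 hδ1 hm hj.1) hj.2,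
    le_upperOutput (h := meanLoss f D) hm hq hε
      (feasible_of_notMem_badBlocks hf hf01 D Q P₀ hδ0 hδ1 hm hk.1) hk.2⟩

lemma measure_failureSet_le {f : Θ → 𝒳 → ℝ} (hf : Measurable (Function.uncurry f))
    (hf01 : ∀ θ x, f θ x ∈ Set.Icc (0 : ℝ) 1) (D : Measure 𝒳) [IsProbabilityMeasure D]
    (Q P₀ : Measure Θ) [IsProbabilityMeasure Q] [IsProbabilityMeasure P₀] {δ : ℝ} (hδ0 : 0 < δ)
    (hδ1 : δ < 1) {n K m : ℕ} (hm : 0 < m) {ε : ℝ} (hε : 0 ≤ ε)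
    (hεK : Real.exp (-(m * ε)) = 2 * δ / K) {x : Fin n → 𝒳} {w : ℝ} (hw : 0 ≤ w)
    (hxw : priorWealth f D P₀ x = ENNReal.ofReal w) {p : ℝ}
    (hp : p = Real.exp (-1) * (1 + max 0 (Real.log (δ * w)) / Real.log (1 / δ))) :
    (Measure.pi fun _ : Fin K => Measure.pi fun _ : Fin m => Q).real
      (failureSet f D Q P₀ δ ε K m x) ≤ min 1 (2 * (p + 2 * δ / K) ^ K - p ^ K) := by
  have hL : 0 < Real.log (1 / δ) := Real.log_pos (by rw [lt_div_iff₀ hδ0]; linarith)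
  have hZ : Measurable fun t => logWealthBound f D x t :=
    (measurable_logWealthBound (n := n) hf D).comp measurable_prodMk_left
  have hs : (0 : ℝ) ≤ 2 * δ / K := by positivity
  refine le_min measureReal_le_one (measure_pi_union_le _ ?_ ?_ ?_ ?_ K)
  · have hsum : Measurable fun θ : Fin m → Θ => ∑ i, logWealthBound f D x (θ i) :=
      Finset.measurable_fun_sum _ fun i _ => hZ.comp (measurable_pi_apply i)
    exact measurableSet_lt measurable_const hsum
  · rw [hp]
    refine measure_badBlocks_le Q hZ hm hL (le_max_left _ _) (le_max_left _ _) ?_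
    rw [← posLog_ofReal_eq_max (by positivity), ENNReal.ofReal_mul hδ0.le, ← hxw]
    -- The mean bound required by Markov holds by construction of the budget.
    exact tsub_le_iff_right.1 (le_max_right _ _)
  · refine ENNReal.toReal_le_of_le_ofReal hs ?_
    rw [← hεK]
    exact measure_lowBlocks_le Q (measurable_meanLoss hf D) (meanLoss_mem_Icc hf hf01 D) hm hε
  · refine ENNReal.toReal_le_of_le_ofReal hs ?_
    rw [← hεK]
    exact measure_highBlocks_le Q (measurable_meanLoss hf D) (meanLoss_mem_Icc hf hf01 D) hm hε

/-- The joint failure probability over the sample and the draws. -/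
lemma compProd_failureSet_le {f : Θ → 𝒳 → ℝ} (hf : Measurable (Function.uncurry f))
    (hf01 : ∀ θ x, f θ x ∈ Set.Icc (0 : ℝ) 1) (D : Measure 𝒳) [IsProbabilityMeasure D]
    (P₀ : Measure Θ) [IsProbabilityMeasure P₀] {δ : ℝ} (hδ0 : 0 < δ) (hδ3 : δ < 1 / 3)
    {n K m : ℕ} (hK : K = ⌈Real.log (1 / δ)⌉₊) (hm : 0 < m)
    (post : Kernel (Fin n → 𝒳) Θ) [IsMarkovKernel post] {ε : ℝ} (hε : 0 ≤ ε)
    (hεK : Real.exp (-(m * ε)) = 2 * δ / K) :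
    ((Measure.pi fun _ : Fin n => D) ⊗ₘ (iidKernel (iidKernel post m) K))
      {p : (Fin n → 𝒳) × (Fin K → Fin m → Θ) |
        p.2 ∈ failureSet f D (post p.1) P₀ δ ε K m p.1} ≤ ENNReal.ofReal (3 * δ) := by
  obtain ⟨c₀, c₁, hc₀, hc₁, hc, hmaj⟩ := exists_affine_majorant hδ0 hδ3 hK
  have hwm := measurable_priorWealth (n := n) hf D P₀
  have hw1 := lintegral_priorWealth_le_one hf hf01 D P₀ n
  rw [Measure.compProd_apply (measurableSet_failureSet hf D P₀ δ ε post)]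
  calc _ ≤ ∫⁻ x, (ENNReal.ofReal c₀ + ENNReal.ofReal c₁ * priorWealth f D P₀ x)
          ∂(Measure.pi fun _ : Fin n => D) := by
        refine lintegral_mono_ae ?_
        -- The prior wealth is finite almost surely since its mean is at most one.
        filter_upwards [ae_lt_top hwm (hw1.trans_lt ENNReal.one_lt_top).ne] with x hx
        have hxw := (ENNReal.ofReal_toReal hx.ne).symm
        have h := measure_failureSet_le (x := x) hf hf01 D (post x) P₀ hδ0 (by linarith) hm hε hεK
          ENNReal.toReal_nonneg hxw rfl
        have h2 := h.trans (hmaj _ _ ENNReal.toReal_nonneg rfl)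
        rw [hxw, ← ENNReal.ofReal_mul hc₁, ← ENNReal.ofReal_add hc₀
          (mul_nonneg hc₁ ENNReal.toReal_nonneg)]
        refine le_trans (le_of_eq ?_) (ENNReal.ofReal_le_ofReal h2)
        rw [ofReal_measureReal]
        rfl
    _ = ENNReal.ofReal c₀ + ENNReal.ofReal c₁ *
          ∫⁻ x, priorWealth f D P₀ x ∂(Measure.pi fun _ : Fin n => D) := by
        rw [lintegral_add_left measurable_const, lintegral_const_mul _ hwm]
        simp
    _ ≤ ENNReal.ofReal c₀ + ENNReal.ofReal c₁ * 1 := by gcongr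
    _ = ENNReal.ofReal (c₀ + c₁) := by rw [mul_one, ENNReal.ofReal_add hc₀ hc₁]
    _ ≤ _ := ENNReal.ofReal_le_ofReal hc

end

end PacBayes

end

/-- The sample `X₁, …, Xₙ` is i.i.d. with law `D`, the posterior is `P_n = post (X₁, …, Xₙ)`, and,
given the sample, the `K` blocks of parameters are independent draws from `P_n^m`. -/
theorem proposition5 {𝒳 Θ Ω : Type*} [MeasurableSpace 𝒳] [MeasurableSpace Θ] [MeasurableSpace Ω]
    (P : Measure Ω) [IsProbabilityMeasure P]
    (D : Measure 𝒳) [IsProbabilityMeasure D]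
    (P₀ : Measure Θ) [IsProbabilityMeasure P₀]
    (f : Θ → 𝒳 → ℝ) (hf : Measurable (Function.uncurry f))
    (hf01 : ∀ θ x, f θ x ∈ Set.Icc (0 : ℝ) 1)
    (n : ℕ) (X : Fin n → Ω → 𝒳) (hX : ∀ i, HasLaw (X i) D P) (hXindep : iIndepFun X P)
    (post : Kernel (Fin n → 𝒳) Θ) [IsMarkovKernel post]
    (δ : ℝ) (hδ0 : 0 < δ) (hδ1 : δ ≤ 1)
    (K : ℕ) (hK : K = ⌈Real.log (1 / δ)⌉₊) (m : ℕ) (hm : 0 < m)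
    (θ : Ω → Fin K → Fin m → Θ)
    (hθ : HasCondDistrib θ (fun ω i => X i ω)
      (PacBayes.iidKernel (PacBayes.iidKernel post m) K) P) :
    ∃ E : Set Ω, MeasurableSet E ∧ ENNReal.ofReal (1 - 3 * δ) ≤ P E ∧
      ∀ ω ∈ E,
        PacBayes.lowerOutput f (post fun i => X i ω) P₀ δ (fun i => X i ω) (θ ω) ≤
            ∫ t, (∫ x, f t x ∂D) ∂(post fun i => X i ω) ∧
          ∫ t, (∫ x, f t x ∂D) ∂(post fun i => X i ω) ≤
            PacBayes.upperOutput f (post fun i => X i ω) P₀ δ (fun i => X i ω) (θ ω) := by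
  rcases le_or_gt (1 / 3) δ with hδ3 | hδ3
  -- For `δ ≥ 1/3` the required probability is nonpositive.
  · refine ⟨∅, MeasurableSet.empty, ?_, fun ω hω => absurd hω (Set.notMem_empty ω)⟩
    rw [ENNReal.ofReal_of_nonpos (by linarith)]
    exact zero_le
  have hL1 : 1 < Real.log (1 / δ) := by
    rw [Real.lt_log_iff_exp_lt (by positivity), lt_div_iff₀ hδ0]
    have := Real.exp_one_lt_d9
    nlinarith [Real.exp_pos 1]
  have hK2 : (2 : ℝ) ≤ K := by
    have : 2 ≤ K := by rw [hK]; exact Nat.lt_ceil.2 (by exact_mod_cast hL1)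
    exact_mod_cast this
  have hm' : (0 : ℝ) < m := by exact_mod_cast hm
  have hε : 0 ≤ Real.log ((K : ℝ) / (2 * δ)) / (m : ℝ) := by
    refine div_nonneg (Real.log_nonneg ?_) hm'.le
    rw [le_div_iff₀ (by positivity)]
    linarith
  have hεK : Real.exp (-(m * (Real.log ((K : ℝ) / (2 * δ)) / (m : ℝ)))) = 2 * δ / K := by
    rw [mul_div_cancel₀ _ hm'.ne', Real.exp_neg, Real.exp_log (by positivity), inv_div]
  set F : Set ((Fin n → 𝒳) × (Fin K → Fin m → Θ)) :=
    {p | p.2 ∈ PacBayes.failureSet f D (post p.1) P₀ δ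
      (Real.log ((K : ℝ) / (2 * δ)) / (m : ℝ)) K m p.1} with hF
  have hFm : MeasurableSet F := PacBayes.measurableSet_failureSet hf D P₀ δ _ post
  have hlaw : HasLaw (fun ω => ((fun i => X i ω), θ ω)) ((Measure.pi fun _ : Fin n => D) ⊗ₘ
      (PacBayes.iidKernel (PacBayes.iidKernel post m) K)) P :=
    (hXindep.hasLaw_pi hX).prodMk_of_hasCondDistrib hθ
  have hPF : P ((fun ω => ((fun i => X i ω), θ ω)) ⁻¹' F) ≤ ENNReal.ofReal (3 * δ) := by
    rw [← Measure.map_apply_of_aemeasurable hlaw.aemeasurable hFm, hlaw.map_eq]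
    exact PacBayes.compProd_failureSet_le hf hf01 D P₀ hδ0 hδ3 hK hm post hε hεK
  -- The pair of sample and draws is only almost everywhere measurable, so the preimage of the
  -- failure set is replaced by a measurable hull of the same probability.
  refine ⟨(toMeasurable P ((fun ω => ((fun i => X i ω), θ ω)) ⁻¹' F))ᶜ,
    (measurableSet_toMeasurable _ _).compl, ?_, fun ω hω => ?_⟩
  · rw [prob_compl_eq_one_sub (measurableSet_toMeasurable _ _), measure_toMeasurable,
      ENNReal.ofReal_sub _ (by positivity), ENNReal.ofReal_one]
    exact tsub_le_tsub_left hPF 1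
  · have hω' : ((fun i => X i ω), θ ω) ∉ F := fun h => hω (subset_toMeasurable _ _ h)
    exact PacBayes.outputs_of_notMem_failureSet hf hf01 D _ P₀ hδ0 hδ1 hm hε hω'
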